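/- Let $X$ be a finite simplicial complex, let $k \in \mathbb{N} = \{0,1,2,\dots\}$, and let $\mathscr{G}$ be a class of groups that is closed under isomorphisms and under finitely generated subgroups (if $\Gamma \in \mathscr{G}$ and $\Lambda \leq \Gamma$ is finitely generated, then $\Lambda \in \mathscr{G}$). Let $\overline{\mathscr{G}}$ be the class of all groups $\Gamma$ such that every finitely generated subgroup of $\Gamma$ lies in $\mathscr{G}$. For a class of groups $\mathscr{H}$ and a topological space $Y$, a subset $U \subseteq Y$ is called an $\mathscr{H}$-set if for every $x \in U$ the image of the homomorphism $\pi_1(U,x) \to \pi_1(Y,x)$ induced by the inclusion lies in $\mathscr{H}$. Let $\operatorname{cat}_{\mathscr{H}}(Y)$ be the minimal $n \in \mathbb{N}$ such that $Y$ has a cover of cardinality $n$ by open $\mathscr{H}$-sets, and $+\infty$ if there is no such $n$. A finite simplicial complex $Y$ satisfies the fibre collapsing assumption with respect to $\mathscr{H}$ in dimension $k$ if there is a simplicial map $f \colon Y \to P$ to a finite simplicial complex $P$ with $\dim P \leq k$ such that for every point $p$ of (the geometric realisation of) $P$, not necessarily a vertex, the fibre $f^{-1}(p)$ is an $\mathscr{H}$-set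 of (the geometric realisation of) $Y$. Then the following are equivalent: 1. There exists an iterated barycentric subdivision of $X$ that satisfies the fibre collapsing assumption with respect to $\mathscr{G}$ in dimension $k$. 2. $\operatorname{cat}_{\mathscr{G}}(X) \leq k+1$. 3. $\operatorname{cat}_{\overline{\mathscr{G}}}(X) \leq k+1$. -/

import Mathlib

universe u

/-! ### Classes of groups -/

/-- A class of groups (a predicate on all groups of a fixed universe). -/
abbrev GroupClass : Type (u + 1) := (Γ : Type u) → [Group Γ] → Prop

namespace GroupClass

/-- The class `𝒢` is closed under isomorphisms. -/
def ClosedUnderIso (𝒢 : GroupClass.{u}) : Prop :=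
  ∀ (Γ Λ : Type u) [Group Γ] [Group Λ], Nonempty (Γ ≃* Λ) → 𝒢 Γ → 𝒢 Λ

/-- The class `𝒢` is closed under finitely generated subgroups. -/
def ClosedUnderFGSubgroups (𝒢 : GroupClass.{u}) : Prop :=
  ∀ (Γ : Type u) [Group Γ], 𝒢 Γ → ∀ Λ : Subgroup Γ, Λ.FG → 𝒢 Λ

/-- The class of all groups all of whose finitely generated subgroups lie in `𝒢`. -/
def closure (𝒢 : GroupClass.{u}) : GroupClass.{u} :=
  fun Γ _ => ∀ Λ : Subgroup Γ, Λ.FG → 𝒢 Λ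

end GroupClass

/-! ### The `𝒢`-category of a topological space -/

section Category

variable (𝒢 : GroupClass.{u}) {X : Type u} [TopologicalSpace X]

/-- The inclusion of a subset of a topological space, as a continuous map. -/
def subsetInclusion (U : Set X) : C(U, X) := ⟨Subtype.val, continuous_subtype_val⟩

/-- `U ⊆ X` is a `𝒢`-set if for all `x ∈ U` the image of `π₁(U, x) → π₁(X, x)` lies in `𝒢`. -/
def IsGSet (U : Set X) : Prop :=
  ∀ x : U, 𝒢 (FundamentalGroup.map (subsetInclusion U) x).range

/-- An open `𝒢`-cover of `X`: a set of open `𝒢`-sets whose union is `X`. -/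
structure IsOpenGCover (𝒰 : Set (Set X)) : Prop where
  isOpen : ∀ U ∈ 𝒰, IsOpen U
  isGSet : ∀ U ∈ 𝒰, IsGSet 𝒢 U
  sUnion_eq : ⋃₀ 𝒰 = Set.univ

variable (X) in
/-- The `𝒢`-category of `X`: the minimal `n : ℕ` such that `X` admits an open `𝒢`-cover of
cardinality `n`, and `⊤` if there is no such `n` (the infimum of the empty set in `ℕ∞` is `⊤`). -/
noncomputable def gCat : ℕ∞ :=
  sInf {n : ℕ∞ | ∃ 𝒰 : Set (Set X), 𝒰.Finite ∧ IsOpenGCover 𝒢 𝒰 ∧ 𝒰.encard = n}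

end Category

/-! ### Finite simplicial complexes -/

/-- A finite (abstract) simplicial complex. Every element of `Vertex` is a vertex of the complex;
the empty complex is allowed. -/
structure FiniteSimplicialComplex : Type (u + 1) where
  Vertex : Type u
  [fintypeVertex : Fintype Vertex]
  complex : AbstractSimplicialComplex Vertex

namespace FiniteSimplicialComplex

attribute [instance] FiniteSimplicialComplex.fintypeVertex

/-- The (nonempty) simplices, given by their vertex sets. -/
def faces (X : FiniteSimplicialComplex.{u}) : Set (Finset X.Vertex) := X.complex.faces

/-- The dimension: the supremum of the dimensions of the simplices (`⊥` for the empty complex). -/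
noncomputable def dim (X : FiniteSimplicialComplex.{u}) : WithBot ℕ∞ :=
  ⨆ s ∈ X.faces, (((s.card - 1 : ℕ) : ℕ∞) : WithBot ℕ∞)

/-- The geometric realisation, in barycentric coordinates, with the topology induced from
`X.Vertex → ℝ`: the union of the closed simplices of `X`. -/
def Realization (X : FiniteSimplicialComplex.{u}) : Type u :=
  {x : stdSimplex ℝ X.Vertex // ∃ s ∈ X.faces, Function.support (x : X.Vertex → ℝ) ⊆ s}

instance (X : FiniteSimplicialComplex.{u}) : TopologicalSpace X.Realization :=
  inferInstanceAs (TopologicalSpace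
    {x : stdSimplex ℝ X.Vertex // ∃ s ∈ X.faces, Function.support (x : X.Vertex → ℝ) ⊆ s})

/-- The barycentric subdivision: its vertices are the simplices of `X`, its simplices are the
nonempty finite chains of simplices of `X` with respect to inclusion. -/
noncomputable def barycentricSubdivision (X : FiniteSimplicialComplex.{u}) :
    FiniteSimplicialComplex.{u} where
  Vertex := {s : Finset X.Vertex // s ∈ X.faces}
  fintypeVertex := Fintype.ofFinite _
  complex :=
    { faces := {c | c.Nonempty ∧
        IsChain (· ≤ ·) (c : Set {s : Finset X.Vertex // s ∈ X.faces})}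
      isRelLowerSet_faces := fun _ hc =>
        ⟨hc.1, fun _ hdc hd => ⟨hd, hc.2.mono (Finset.coe_subset.mpr hdc)⟩⟩
      singleton_mem := fun v =>
        ⟨Finset.singleton_nonempty v, by rw [Finset.coe_singleton]; exact IsChain.singleton⟩ }

/-- A simplicial map: a map on vertices that maps simplices to simplices. -/
structure SimplicialMap (X P : FiniteSimplicialComplex.{u}) where
  toFun : X.Vertex → P.Vertex
  image_mem_faces : ∀ s ∈ X.faces, ∃ t ∈ P.faces, (t : Set P.Vertex) = toFun '' (s : Set X.Vertex)

/-- The map on geometric realisations induced by a simplicial map, affine on each simplex. -/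
noncomputable def SimplicialMap.realize {X P : FiniteSimplicialComplex.{u}}
    (f : SimplicialMap X P) (x : X.Realization) : P.Realization :=
  ⟨stdSimplex.map f.toFun x.1, by
    obtain ⟨s, hs, hx⟩ := x.2
    obtain ⟨t, ht, hts⟩ := f.image_mem_faces s hs
    refine ⟨t, ht, fun w hw => ?_⟩
    rw [hts]
    classical
    rw [Function.mem_support, stdSimplex.map_coe, FunOnFinite.linearMap_apply_apply] at hw
    obtain ⟨v, hv, hxv⟩ := Finset.exists_ne_zero_of_sum_ne_zero hw
    exact ⟨v, hx hxv, by simpa using hv⟩⟩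

/-- The fibre collapsing assumption with respect to `𝒢` in dimension `k`: there is a simplicial
map to a finite simplicial complex of dimension at most `k` such that all fibres over points of
the realisation are `𝒢`-sets. -/
def FibreCollapsing (𝒢 : GroupClass.{u}) (k : ℕ) (X : FiniteSimplicialComplex.{u}) : Prop :=
  ∃ (P : FiniteSimplicialComplex.{u}) (f : SimplicialMap X P),
    P.dim ≤ (k : WithBot ℕ∞) ∧ ∀ p : P.Realization, IsGSet 𝒢 (f.realize ⁻¹' {p})

end FiniteSimplicialComplex

/-! Rescaling barycentric coordinates is the tool for both directions. Let `f : X → P` be simplicial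
and `p` a point of `P`. If `f x` is nonzero in every coordinate where `p` is, multiplying the
coordinates of `x` over each vertex `c` of `P` by `p_c / f(x)_c` gives a point of the fibre over `p`
in a common closed simplex with `x` (`toFibre`). Straight lines therefore retract the preimage of
the open star around `p` onto the fibre, and conjugation along such a line compares images of
fundamental groups.

From fibres to covers: the open stars of barycentres of simplices of `P` of equal dimension are
disjoint, so grouping them by dimension covers `P` by at most `k + 1` open sets. Each star preimage
retracts onto the fibre over a barycentre, hence is a `𝒢`-set, and disjoint open unions preserve
this. Subdividing does not change the realisation up to homeomorphism. Closure under finitely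
generated subgroups gives 2 → 3.

From covers to fibres: after enough subdivisions every open vertex star lies in a member of the
cover (Lebesgue number). Choosing such a member for each vertex is a colouring, that is, a
simplicial map to a full simplex of dimension at most `k`. If `p_i ≠ 0`, the fibre over `p` can be
pushed into the fibre over vertex `i`, which lies in `U i`; so its group embeds by conjugation in
that of `U i`, which is in the closure of `𝒢`. It lies in `𝒢` itself because it is finitely
generated: the fibre is a retract of a finite union of open stars of simplices, whose intersections
are empty or stars again, and a nerve-type argument (`fg_loopSubgroup_iUnion`) applies. -/

open CategoryTheory unitInterval

/-! ### Path classes, and finite generation for good covers -/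

section PathClasses

variable {X : Type*} [TopologicalSpace X]

/-- A homotopy class of paths is represented in `U` if it contains a path that stays in `U`. -/
def RepresentedIn (U : Set X) {x y : X} (g : Path.Homotopic.Quotient x y) : Prop :=
  ∃ γ : Path x y, (∀ t, γ t ∈ U) ∧ Path.Homotopic.Quotient.mk γ = g

theorem RepresentedIn.mk {U : Set X} {x y : X} (γ : Path x y) (h : ∀ t, γ t ∈ U) :
    RepresentedIn U (Path.Homotopic.Quotient.mk γ) := ⟨γ, h, rfl⟩

theorem RepresentedIn.mono {U V : Set X} (h : U ⊆ V) {x y : X} {g : Path.Homotopic.Quotient x y}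
    (hg : RepresentedIn U g) : RepresentedIn V g :=
  let ⟨γ, hγ, e⟩ := hg
  ⟨γ, fun t => h (hγ t), e⟩

theorem RepresentedIn.trans {U : Set X} {x y z : X} {g : Path.Homotopic.Quotient x y}
    {h : Path.Homotopic.Quotient y z} (hg : RepresentedIn U g) (hh : RepresentedIn U h) :
    RepresentedIn U (g.trans h) := by
  obtain ⟨γ, hγ, rfl⟩ := hg
  obtain ⟨δ, hδ, rfl⟩ := hh
  refine ⟨γ.trans δ, fun t => ?_, rfl⟩
  rw [Path.trans_apply]
  split_ifs
  exacts [hγ _, hδ _]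

theorem RepresentedIn.symm {U : Set X} {x y : X} {g : Path.Homotopic.Quotient x y}
    (hg : RepresentedIn U g) : RepresentedIn U g.symm := by
  obtain ⟨γ, hγ, rfl⟩ := hg
  exact ⟨γ.symm, fun t => hγ _, rfl⟩

/-- The image of `π₁(U, x) → π₁(X, x)`. -/
noncomputable def loopSubgroup (U : Set X) (x : X) (hx : x ∈ U) : Subgroup (FundamentalGroup X x) :=
  (FundamentalGroup.map (subsetInclusion U) ⟨x, hx⟩).range

theorem mem_loopSubgroup {U : Set X} {x : X} (hx : x ∈ U) (g : FundamentalGroup X x) :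
    g ∈ loopSubgroup U x hx ↔ RepresentedIn U g.toPath := by
  constructor
  · rintro ⟨q, rfl⟩
    obtain ⟨γ, rfl⟩ := Path.Homotopic.Quotient.mk_surjective q
    exact ⟨γ.map continuous_subtype_val, fun t => (γ t).2, rfl⟩
  · rintro ⟨γ, hγ, e⟩
    refine ⟨Path.Homotopic.Quotient.mk ⟨⟨fun t => (⟨γ t, hγ t⟩ : U), by fun_prop⟩, ?_, ?_⟩, ?_⟩
    · exact Subtype.ext γ.source
    · exact Subtype.ext γ.target
    · exact e

theorem isGSet_iff {X : Type u} [TopologicalSpace X] {𝒢 : GroupClass.{u}} {U : Set X} :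
    IsGSet 𝒢 U ↔ ∀ x hx, 𝒢 (loopSubgroup U x hx) :=
  ⟨fun h x hx => h ⟨x, hx⟩, fun h x => h x x.2⟩

theorem Path.Homotopic.Quotient.symm_trans_rev {x y z : X} (a : Path.Homotopic.Quotient x y)
    (b : Path.Homotopic.Quotient y z) : (a.trans b).symm = b.symm.trans a.symm := by
  obtain ⟨a, rfl⟩ := Path.Homotopic.Quotient.mk_surjective a
  obtain ⟨b, rfl⟩ := Path.Homotopic.Quotient.mk_surjective b
  rw [← mk_trans, ← mk_symm, ← mk_symm, ← mk_symm, ← mk_trans, Path.trans_symm]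

theorem Path.Homotopic.Quotient.trans_symm_cancel {x y z : X} (a : Path.Homotopic.Quotient x y)
    (b : Path.Homotopic.Quotient x z) : a.trans (a.symm.trans b) = b := by
  rw [← trans_assoc, trans_symm, refl_trans]

theorem Path.Homotopic.Quotient.symm_trans_cancel {x y z : X} (a : Path.Homotopic.Quotient y x)
    (b : Path.Homotopic.Quotient x z) : a.symm.trans (a.trans b) = b := by
  rw [← trans_assoc, symm_trans, refl_trans]

/-- Conjugation of loop classes along a path. -/
theorem fundamentalGroupMulEquivOfPath_apply {x y : X} (δ : Path x y)
    (g : FundamentalGroup X x) :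
    (FundamentalGroup.fundamentalGroupMulEquivOfPath δ g).toPath =
      (Path.Homotopic.Quotient.mk δ).symm.trans (g.toPath.trans (Path.Homotopic.Quotient.mk δ)) :=
  rfl

/-- The boundary of a continuous square commutes up to homotopy. -/
theorem homotopic_of_square (F : I × I → X) (hF : Continuous F) {a b c d : X}
    (p : Path a b) (q : Path b d) (r : Path a c) (s : Path c d)
    (hp : ∀ t, p t = F (0, t)) (hq : ∀ t, q t = F (t, 1)) (hr : ∀ t, r t = F (t, 0))
    (hs : ∀ t, s t = F (1, t)) :
    (p.trans q).Homotopic (r.trans s) := by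
  have ha : a = F (0, 0) := by rw [← hp, p.source]
  have hb : b = F (0, 1) := by rw [← hp, p.target]
  have hc : c = F (1, 0) := by rw [← hs, s.source]
  have hd : d = F (1, 1) := by rw [← hs, s.target]
  subst ha hb hc hd
  -- Both boundary paths exist in the contractible square, where they are homotopic; `F` pushes the
  -- homotopy forward.
  have : ContractibleSpace (I × I) := by
    have : ContractibleSpace I := (convex_Icc (0 : ℝ) 1).contractibleSpace ⟨0, by simp⟩
    infer_instance
  let p' : Path ((0, 0) : I × I) (0, 1) := ⟨⟨fun t => (0, t), by fun_prop⟩, rfl, rfl⟩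
  let q' : Path ((0, 1) : I × I) (1, 1) := ⟨⟨fun t => (t, 1), by fun_prop⟩, rfl, rfl⟩
  let r' : Path ((0, 0) : I × I) (1, 0) := ⟨⟨fun t => (t, 0), by fun_prop⟩, rfl, rfl⟩
  let s' : Path ((1, 0) : I × I) (1, 1) := ⟨⟨fun t => (1, t), by fun_prop⟩, rfl, rfl⟩
  have h := (SimplyConnectedSpace.paths_homotopic (p'.trans q') (r'.trans s')).map ⟨F, hF⟩
  have e1 : p = p'.map hF := by ext t; exact hp t
  have e2 : q = q'.map hF := by ext t; exact hq t
  have e3 : r = r'.map hF := by ext t; exact hr t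
  have e4 : s = s'.map hF := by ext t; exact hs t
  rw [e1, e2, e3, e4, ← Path.map_trans, ← Path.map_trans]
  exact h

/-- If finitely many open sets have the property that paths inside each of them are determined up
to homotopy by their endpoints, and their pairwise intersections are path-connected or empty, then
loops in their union generate a finitely generated subgroup of the fundamental group. -/
theorem fg_loopSubgroup_iUnion {ι : Type*} [Finite ι] {A : ι → Set X}
    (hA : ∀ i, IsOpen (A i))
    (huniq : ∀ i (x y : X) (p q : Path x y), (∀ t, p t ∈ A i) → (∀ t, q t ∈ A i) → p.Homotopic q)
    (hjoin : ∀ i j (x y : X), x ∈ A i → y ∈ A i → x ∈ A j → y ∈ A j →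
      ∃ p : Path x y, ∀ t, p t ∈ A i ∧ p t ∈ A j)
    {U : Set X} (hU : U = ⋃ i, A i) (x : X) (hx : x ∈ U) :
    (loopSubgroup U x hx).FG := by
  have hAU : ∀ i, A i ⊆ U := fun i => hU ▸ Set.subset_iUnion A i
  -- Indices of sets reachable from `x` inside `U`; only these affect loops at `x`.
  let R : ι → Prop := fun i => ∃ z ∈ A i, ∃ q : Path x z, ∀ t, q t ∈ U
  -- A preferred class from `x` to each point of `A i`, compatible with paths in `A i`: a fixed path
  -- into `A i` followed by any path inside it.
  have hD : ∀ i, R i → ∃ D : ∀ y, y ∈ A i → Path.Homotopic.Quotient x y,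
      (∀ y hy, RepresentedIn U (D y hy)) ∧
      ∀ y y' hy hy' (β : Path.Homotopic.Quotient y y'), RepresentedIn (A i) β →
        D y' hy' = (D y hy).trans β := by
    rintro i ⟨z, hz, q, hq⟩
    choose c hc using fun y (hy : y ∈ A i) => hjoin i i z y hz hy hz hy
    refine ⟨fun y hy => (Path.Homotopic.Quotient.mk q).trans (.mk (c y hy)), fun y hy => ?_, ?_⟩
    · exact (RepresentedIn.mk q hq).trans (RepresentedIn.mk _ fun t => hAU i (hc y hy t).1)
    · rintro y y' hy hy' _ ⟨β, hβ, rfl⟩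
      beta_reduce
      rw [Path.Homotopic.Quotient.trans_assoc]
      congr 1
      rw [← Path.Homotopic.Quotient.mk_trans, Path.Homotopic.Quotient.eq]
      refine huniq i _ _ _ _ (fun t => (hc y' hy' t).1) fun t => ?_
      rw [Path.trans_apply]
      split_ifs
      exacts [(hc y hy _).1, hβ _]
  choose D hDU hDtr using hD
  -- Generators: the transitions from `D i` to `D j` at a common point, and the loops `D i` at `x`
  -- itself. The former do not depend on the common point, since intersections are path-connected;
  -- hence `S` is finite.
  let S : Set (FundamentalGroup X x) :=
    (⋃ i, ⋃ j, {g | ∃ (hi : R i) (hj : R j) (y : X) (hyi : y ∈ A i) (hyj : y ∈ A j),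
      g = FundamentalGroup.fromPath ((D i hi y hyi).trans (D j hj y hyj).symm)}) ∪
    ⋃ i, {g | ∃ (hi : R i) (hx : x ∈ A i), g = FundamentalGroup.fromPath (D i hi x hx)}
  have hSfin : S.Finite := by
    refine (Set.finite_iUnion fun i => Set.finite_iUnion fun j => Set.Subsingleton.finite ?_).union
      (Set.finite_iUnion fun i => Set.Subsingleton.finite ?_)
    · rintro _ ⟨hi, hj, y, hyi, hyj, rfl⟩ _ ⟨_, _, y', hyi', hyj', rfl⟩
      obtain ⟨p, hp⟩ := hjoin i j y y' hyi hyi' hyj hyj'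
      rw [hDtr i hi y y' hyi hyi' (.mk p) (.mk p fun t => (hp t).1),
        hDtr j hj y y' hyj hyj' (.mk p) (.mk p fun t => (hp t).2), Path.Homotopic.Quotient.symm_trans_rev,
        Path.Homotopic.Quotient.trans_assoc, Path.Homotopic.Quotient.trans_symm_cancel]
    · rintro _ ⟨_, _, rfl⟩ _ ⟨_, _, rfl⟩
      rfl
  rw [Subgroup.fg_iff]
  refine ⟨S, le_antisymm ?_ ?_, hSfin⟩
  · rw [Subgroup.closure_le]
    intro g hg
    rw [SetLike.mem_coe, mem_loopSubgroup]
    simp only [S, Set.mem_union, Set.mem_iUnion, Set.mem_ofPred_eq] at hg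
    obtain ⟨i, j, hi, hj, y, hyi, hyj, rfl⟩ | ⟨i, hi, hx, rfl⟩ := hg
    · exact (hDU _ _ _ _).trans (hDU _ _ _ _).symm
    · exact hDU _ _ _ _
  · intro g hg
    rw [mem_loopSubgroup] at hg
    obtain ⟨γ, hγ, rfl⟩ := hg
    have hR : ∀ t i, γ t ∈ A i → R i := fun t i hi =>
      ⟨_, hi, (γ.subpath 0 t).cast γ.source.symm rfl, fun s => hγ _⟩
    let F : ∀ t, Path.Homotopic.Quotient x (γ t) := fun t =>
      .mk ((γ.subpath 0 t).cast γ.source.symm rfl)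
    have hF : ∀ s t, F t = (F s).trans (.mk (γ.subpath s t)) := fun s t => by
      have := (Path.Homotopy.subpathTransSubpath γ 0 s t).pathCast γ.source.symm rfl
      exact (Path.Homotopic.Quotient.eq.2 ⟨this⟩).symm
    obtain ⟨t, ht0, htmono, ⟨n, hn⟩, htA⟩ :=
      exists_monotone_Icc_subset_open_cover_unitInterval (c := fun i => γ ⁻¹' A i)
        (fun i => (hA i).preimage γ.continuous) (by
          intro t _
          have := hγ t
          rw [hU] at this
          simpa using this)
    -- Close up the initial piece of `γ` by the preferred path of any `A i` containing its endpoint.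
    -- Each subdivision interval stays in one `A j`, so advancing by it costs only a transition from
    -- `j` to `i`.
    have key : ∀ n i (hi : γ (t n) ∈ A i), FundamentalGroup.fromPath
        ((F (t n)).trans (D i (hR _ i hi) _ hi).symm) ∈ Subgroup.closure S := by
      intro n
      induction n with
      | zero =>
        rw [ht0]
        intro i hi
        have hxi : x ∈ A i := γ.source ▸ hi
        have hF0 : RepresentedIn (A i) (F 0) := .mk _ fun s => by
          change γ.subpath 0 0 s ∈ A i
          rw [Path.subpath_self]
          exact hi
        rw [hDtr i _ _ _ hxi hi _ hF0, Path.Homotopic.Quotient.symm_trans_rev,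
          Path.Homotopic.Quotient.trans_symm_cancel]
        exact inv_mem (Subgroup.subset_closure (Or.inr (Set.mem_iUnion.2 ⟨i, hR 0 i hi, hxi, rfl⟩)))
      | succ n ih =>
        intro i hi
        obtain ⟨j, hj⟩ := htA n
        have hj0 : γ (t n) ∈ A j := hj ⟨le_rfl, htmono n.le_succ⟩
        have hj1 : γ (t (n + 1)) ∈ A j := hj ⟨htmono n.le_succ, le_rfl⟩
        have h1 := ih j hj0
        have hβ : RepresentedIn (A j)
            (Path.Homotopic.Quotient.mk (γ.subpath (t n) (t (n + 1)))) := by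
          refine .mk _ fun s => ?_
          have : γ.subpath (t n) (t (n + 1)) s ∈ γ '' Set.Icc (t n) (t (n + 1)) := by
            rw [← Path.range_subpath_of_le _ _ _ (htmono n.le_succ)]
            exact ⟨s, rfl⟩
          obtain ⟨r, hr, e⟩ := this
          rw [← e]
          exact hj hr
        have h2 : FundamentalGroup.fromPath ((D j (hR _ j hj1) _ hj1).trans
            (D i (hR _ i hi) _ hi).symm) ∈ Subgroup.closure S :=
          Subgroup.subset_closure (Or.inl (Set.mem_iUnion.2 ⟨j, Set.mem_iUnion.2 ⟨i, _, _, _, _, _, rfl⟩⟩))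
        -- The product `h2 * h1` traverses `h1` first.
        have h3 := mul_mem h2 h1
        convert h3 using 1
        rw [hDtr j _ _ _ hj0 hj1 _ hβ, hF (t n) (t (n + 1))]
        change _ = Path.Homotopic.Quotient.trans _ _
        simp only [Path.Homotopic.Quotient.trans_assoc,
          Path.Homotopic.Quotient.symm_trans_cancel]
    have hone := key n
    rw [hn n le_rfl] at hone
    have hx' := hx
    rw [hU, Set.mem_iUnion] at hx'
    obtain ⟨i, hxi⟩ := hx'
    have h1i : γ 1 ∈ A i := γ.target.symm ▸ hxi
    have h1 := hone i h1i
    -- The endpoints `γ 1` and `x` agree only propositionally; `K` is the constant path between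
    -- them.
    let K : Path.Homotopic.Quotient x (γ 1) := .mk ((Path.refl x).cast rfl γ.target)
    have hF1 : F 1 = Path.Homotopic.Quotient.trans (.mk γ) K := by
      have : ∀ y (e : y = x), Path.Homotopic.Quotient.mk (γ.cast rfl e) =
          Path.Homotopic.Quotient.trans (.mk γ) (.mk ((Path.refl x).cast rfl e)) := by
        rintro _ rfl
        simp
      rw [← this]
      simp only [F, Path.subpath_zero_one]
      rfl
    rw [hDtr i _ _ _ hxi h1i K (.mk _ fun t => hxi), hF1, Path.Homotopic.Quotient.symm_trans_rev,
      Path.Homotopic.Quotient.trans_assoc, Path.Homotopic.Quotient.trans_symm_cancel] at h1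
    have h2 : FundamentalGroup.fromPath (D i (hR 1 i h1i) x hxi) ∈ Subgroup.closure S :=
      Subgroup.subset_closure (Or.inr (Set.mem_iUnion.2 ⟨i, hR 1 i h1i, hxi, rfl⟩))
    have h3 := mul_mem h2 h1
    convert h3 using 1
    change _ = Path.Homotopic.Quotient.trans _ _
    rw [Path.Homotopic.Quotient.trans_assoc, Path.Homotopic.Quotient.symm_trans,
      Path.Homotopic.Quotient.trans_refl]

end PathClasses

/-! ### Classes of groups -/

section GroupClasses

variable {𝒢 : GroupClass.{u}}

theorem Subgroup.FG.of_mulEquiv {Γ Λ : Type*} [Group Γ] [Group Λ] {K : Subgroup Γ}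
    {H : Subgroup Λ} (hK : K.FG) (e : K ≃* H) : H.FG := by
  have : Group.FG K := (Group.fg_iff_subgroup_fg K).2 hK
  have : Group.FG H := Group.fg_of_surjective (f := e.toMonoidHom) e.surjective
  exact (Group.fg_iff_subgroup_fg _).1 this

theorem GroupClass.le_closure (hfg : 𝒢.ClosedUnderFGSubgroups) (Γ : Type u) [Group Γ]
    (h : 𝒢 Γ) : 𝒢.closure Γ := fun Λ hΛ => hfg Γ h Λ hΛ

theorem GroupClass.ClosedUnderIso.closure (hiso : 𝒢.ClosedUnderIso) :
    𝒢.closure.ClosedUnderIso := by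
  rintro Γ Λ _ _ ⟨e⟩ h K hK
  let K' : Subgroup Γ := K.map e.symm.toMonoidHom
  have e1 : K ≃* K' := K.equivMapOfInjective e.symm.toMonoidHom e.symm.injective
  have hK' : K'.FG := (hK.of_mulEquiv e1)
  exact hiso K' K ⟨e1.symm⟩ (h K' hK')

/-- Finite generation is what brings a group from the closure back to `𝒢`: the image of `K` is a
finitely generated subgroup of `H`. -/
theorem GroupClass.of_fg_of_map_le {Γ Λ : Type u} [Group Γ] [Group Λ]
    (hiso : 𝒢.ClosedUnderIso) (e : Γ ≃* Λ) {K : Subgroup Γ} {H : Subgroup Λ} (hK : K.FG)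
    (hle : K.map e.toMonoidHom ≤ H) (hH : 𝒢.closure H) : 𝒢 K := by
  let K' : Subgroup Λ := K.map e.toMonoidHom
  have e1 : K ≃* K' := K.equivMapOfInjective e.toMonoidHom e.injective
  have e2 : K'.subgroupOf H ≃* K' := Subgroup.subgroupOfEquivOfLe hle
  have hK' : (K'.subgroupOf H).FG := hK.of_mulEquiv (e1.trans e2.symm)
  exact hiso _ _ ⟨e2.trans e1.symm⟩ (hH _ hK')

end GroupClasses

/-! ### Comparing images of fundamental groups -/

section LoopSubgroups

/-- The homotopy from `γ.trans δ` to `δ.trans γ'` says that conjugation along `δ` takes the class of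
`γ` to that of `γ'`. -/
theorem loopSubgroup_map_le {X : Type*} [TopologicalSpace X] {U V : Set X} {x y : X}
    (δ : Path x y) (hx : x ∈ U) (hy : y ∈ V)
    (h : ∀ γ : Path x x, (∀ t, γ t ∈ U) →
      ∃ γ' : Path y y, (∀ t, γ' t ∈ V) ∧ (γ.trans δ).Homotopic (δ.trans γ')) :
    (loopSubgroup U x hx).map
      (FundamentalGroup.fundamentalGroupMulEquivOfPath δ).toMonoidHom ≤ loopSubgroup V y hy := by
  rintro _ ⟨g, hg, rfl⟩
  obtain ⟨γ, hγ, rfl⟩ := (mem_loopSubgroup hx g).1 hg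
  obtain ⟨γ', hγ', hh⟩ := h γ hγ
  refine (mem_loopSubgroup hy _).2 ⟨γ', hγ', ?_⟩
  have := Path.Homotopic.Quotient.eq.2 hh
  rw [Path.Homotopic.Quotient.mk_trans, Path.Homotopic.Quotient.mk_trans] at this
  change _ = FundamentalGroup.toPath (FundamentalGroup.fundamentalGroupMulEquivOfPath δ _)
  rw [fundamentalGroupMulEquivOfPath_apply]
  change _ = Path.Homotopic.Quotient.trans _ (Path.Homotopic.Quotient.trans (.mk γ) _)
  rw [this, Path.Homotopic.Quotient.symm_trans_cancel]

theorem loopSubgroup_mono {X : Type*} [TopologicalSpace X] {U V : Set X} (h : U ⊆ V) {x : X}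
    (hx : x ∈ U) : loopSubgroup U x hx ≤ loopSubgroup V x (h hx) := fun g hg =>
  (mem_loopSubgroup _ g).2 (((mem_loopSubgroup hx g).1 hg).mono h)

/-- If `U ⊆ V` contains `y` and loops in `V` at `x` can be moved along a path in `V` to loops
in `U`, then the loop subgroups are conjugate. -/
theorem loopSubgroup_map_eq {X : Type*} [TopologicalSpace X] {U V : Set X} {x y : X}
    (δ : Path x y) (hx : x ∈ V) (hy : y ∈ U) (hUV : U ⊆ V) (hδ : ∀ t, δ t ∈ V)
    (h : ∀ γ : Path x x, (∀ t, γ t ∈ V) →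
      ∃ γ' : Path y y, (∀ t, γ' t ∈ U) ∧ (γ.trans δ).Homotopic (δ.trans γ')) :
    (loopSubgroup V x hx).map
      (FundamentalGroup.fundamentalGroupMulEquivOfPath δ).toMonoidHom = loopSubgroup U y hy := by
  refine le_antisymm (loopSubgroup_map_le δ hx hy h) fun g hg => ?_
  -- Conversely, conjugating back a loop in `U` gives a loop in `V`, because `δ` stays in `V`.
  refine ⟨(FundamentalGroup.fundamentalGroupMulEquivOfPath δ).symm g, ?_,
    MulEquiv.apply_symm_apply _ g⟩
  have hg' := ((mem_loopSubgroup hy g).1 hg).mono hUV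
  have hδ' := RepresentedIn.mk δ hδ
  exact (mem_loopSubgroup hx _).2 (hδ'.trans (hg'.trans hδ'.symm))

theorem IsGSet.preimage_homeomorph {X Y : Type u} [TopologicalSpace X] [TopologicalSpace Y]
    {𝒢 : GroupClass.{u}} (hiso : 𝒢.ClosedUnderIso) (e : X ≃ₜ Y) {U : Set Y}
    (hU : IsGSet 𝒢 U) : IsGSet 𝒢 (e ⁻¹' U) := by
  rw [isGSet_iff] at hU ⊢
  intro x hx
  let φ := FundamentalGroup.map (⟨e, e.continuous⟩ : C(X, Y)) x
  have hφ : Function.Injective φ := by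
    intro a b hab
    obtain ⟨a, rfl⟩ := Path.Homotopic.Quotient.mk_surjective a
    obtain ⟨b, rfl⟩ := Path.Homotopic.Quotient.mk_surjective b
    have h1 : (a.map e.continuous).Homotopic (b.map e.continuous) :=
      Path.Homotopic.Quotient.eq.1 hab
    have h2 := (h1.map ⟨e.symm, e.symm.continuous⟩).pathCast (e.symm_apply_apply x).symm
      (e.symm_apply_apply x).symm
    refine Path.Homotopic.Quotient.eq.2 ?_
    convert h2 using 1 <;> ext t <;> simp
  have hmap : (loopSubgroup (e ⁻¹' U) x hx).map φ = loopSubgroup U (e x) hx := by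
    ext g
    constructor
    · rintro ⟨g, hg, rfl⟩
      obtain ⟨γ, hγ, rfl⟩ := (mem_loopSubgroup hx g).1 hg
      exact (mem_loopSubgroup _ _).2 ⟨γ.map e.continuous, hγ, rfl⟩
    · intro hg
      obtain ⟨γ, hγ, rfl⟩ := (mem_loopSubgroup _ g).1 hg
      let γ' : Path x x := (γ.map e.symm.continuous).cast (e.symm_apply_apply x).symm
        (e.symm_apply_apply x).symm
      have hγ' : γ'.map e.continuous = γ := by ext t; simp [γ']
      refine ⟨Path.Homotopic.Quotient.mk γ', (mem_loopSubgroup hx _).2 ⟨γ', fun t => ?_, rfl⟩, ?_⟩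
      · change e (γ' t) ∈ U
        simpa [γ'] using hγ t
      · change Path.Homotopic.Quotient.mk (γ'.map e.continuous) = Path.Homotopic.Quotient.mk γ
        rw [hγ']
  have e1 := (loopSubgroup (e ⁻¹' U) x hx).equivMapOfInjective φ hφ
  rw [hmap] at e1
  exact hiso _ _ ⟨e1.symm⟩ (hU (e x) hx)

theorem gCat_le_of_homeomorph {X Y : Type u} [TopologicalSpace X] [TopologicalSpace Y]
    {𝒢 : GroupClass.{u}} (hiso : 𝒢.ClosedUnderIso) (e : X ≃ₜ Y) : gCat 𝒢 X ≤ gCat 𝒢 Y := by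
  refine le_sInf ?_
  rintro _ ⟨𝒰, hfin, h𝒰, rfl⟩
  suffices h : IsOpenGCover 𝒢 ((fun U => e ⁻¹' U) '' 𝒰) by
    have h1 : gCat 𝒢 X ≤ ((fun U => e ⁻¹' U) '' 𝒰).encard := sInf_le ⟨_, hfin.image _, h, rfl⟩
    exact h1.trans (Set.encard_image_le _ _)
  refine ⟨?_, ?_, ?_⟩
  · rintro _ ⟨U, hU, rfl⟩
    exact (h𝒰.isOpen U hU).preimage e.continuous
  · rintro _ ⟨U, hU, rfl⟩
    exact (h𝒰.isGSet U hU).preimage_homeomorph hiso e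
  · rw [Set.sUnion_image, ← Set.preimage_iUnion₂, ← Set.sUnion_eq_biUnion, h𝒰.sUnion_eq,
      Set.preimage_univ]

/-- A loop in a disjoint union of open sets stays in one of them. -/
theorem IsGSet.iUnion_of_pairwise_disjoint {X : Type u} [TopologicalSpace X]
    {𝒢 : GroupClass.{u}} {ι : Type*} {V : ι → Set X} (hV : ∀ i, IsOpen (V i))
    (hdisj : Pairwise fun i j => Disjoint (V i) (V j)) (hG : ∀ i, IsGSet 𝒢 (V i)) :
    IsGSet 𝒢 (⋃ i, V i) := by
  rw [isGSet_iff]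
  intro x hx
  obtain ⟨i, hi⟩ := Set.mem_iUnion.1 hx
  have : loopSubgroup (⋃ i, V i) x hx = loopSubgroup (V i) x hi := by
    refine le_antisymm (fun g hg => ?_) (loopSubgroup_mono (Set.subset_iUnion V i) hi)
    obtain ⟨γ, hγ, rfl⟩ := (mem_loopSubgroup _ g).1 hg
    refine (mem_loopSubgroup _ _).2 ⟨γ, fun t => ?_, rfl⟩
    have hsub : Set.range γ ⊆ V i := by
      refine (isPreconnected_range γ.continuous).subset_left_of_subset_union (hV i)
        (v := ⋃ j ∈ {j | j ≠ i}, V j) (isOpen_biUnion fun j _ => hV j) ?_ ?_ ⟨x, ⟨0, γ.source⟩, hi⟩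
      · exact Set.disjoint_iUnion₂_right.2 fun j hj => hdisj (Ne.symm hj)
      · rintro _ ⟨s, rfl⟩
        obtain ⟨j, hj⟩ := Set.mem_iUnion.1 (hγ s)
        by_cases h : j = i
        · exact Or.inl (h ▸ hj)
        · exact Or.inr (Set.mem_biUnion h hj)
    exact hsub ⟨t, rfl⟩
  rw [this]
  exact isGSet_iff.1 (hG i) x hi

end LoopSubgroups

/-! ### Barycentric coordinates and straight-line homotopies -/

namespace FiniteSimplicialComplex

variable {X P : FiniteSimplicialComplex.{u}}

theorem faces_nonempty {s : Finset X.Vertex} (hs : s ∈ X.faces) : s.Nonempty :=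
  (X.complex.isRelLowerSet_faces hs).1

theorem faces_down_closed {s t : Finset X.Vertex} (hs : s ∈ X.faces) (hts : t ⊆ s)
    (ht : t.Nonempty) : t ∈ X.faces :=
  (X.complex.isRelLowerSet_faces hs).2 hts ht

namespace Realization

/-- The barycentric coordinates of a point. -/
def coord (x : X.Realization) (v : X.Vertex) : ℝ := x.1.1 v

theorem ext {x y : X.Realization} (h : ∀ v, x.coord v = y.coord v) : x = y :=
  Subtype.ext (Subtype.ext (funext h))

theorem coord_nonneg (x : X.Realization) (v : X.Vertex) : 0 ≤ x.coord v := x.1.2.1 v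

theorem sum_coord (x : X.Realization) : ∑ v, x.coord v = 1 := x.1.2.2

theorem exists_face (x : X.Realization) : ∃ s ∈ X.faces, ∀ v, x.coord v ≠ 0 → v ∈ s :=
  let ⟨s, hs, h⟩ := x.2
  ⟨s, hs, fun _ hv => h hv⟩

theorem exists_coord_ne_zero (x : X.Realization) : ∃ v, x.coord v ≠ 0 := by
  by_contra! h
  simpa [h] using x.sum_coord

theorem mem_faces (x : X.Realization) {s : Finset X.Vertex} (hs : s.Nonempty)
    (h : ∀ v ∈ s, x.coord v ≠ 0) : s ∈ X.faces :=
  let ⟨_, ht, htx⟩ := x.exists_face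
  faces_down_closed ht (fun v hv => htx v (h v hv)) hs

/-- The point with given barycentric coordinates. -/
def mk (a : X.Vertex → ℝ) (h0 : ∀ v, 0 ≤ a v) (h1 : ∑ v, a v = 1)
    (h : ∃ s ∈ X.faces, ∀ v, a v ≠ 0 → v ∈ s) : X.Realization :=
  ⟨⟨a, h0, h1⟩, let ⟨s, hs, hsa⟩ := h; ⟨s, hs, fun v hv => hsa v hv⟩⟩

@[simp]
theorem coord_mk (a : X.Vertex → ℝ) (h0 h1 h) (v : X.Vertex) :
    (mk a h0 h1 h).coord v = a v := rfl

theorem isInducing_coord : Topology.IsInducing (coord : X.Realization → X.Vertex → ℝ) :=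
  Topology.IsInducing.subtypeVal.comp Topology.IsInducing.subtypeVal

theorem continuous_coord (v : X.Vertex) : Continuous fun x : X.Realization => x.coord v :=
  (continuous_apply v).comp isInducing_coord.continuous

theorem continuous_iff {T : Type*} [TopologicalSpace T] {F : T → X.Realization} :
    Continuous F ↔ ∀ v, Continuous fun t => (F t).coord v := by
  rw [isInducing_coord.continuous_iff, continuous_pi_iff]
  rfl

instance : T2Space X.Realization :=
  inferInstanceAs (T2Space
    {x : stdSimplex ℝ X.Vertex // ∃ s ∈ X.faces, Function.support (x : X.Vertex → ℝ) ⊆ s})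

instance : CompactSpace X.Realization := by
  have hcl : IsClosed {x : stdSimplex ℝ X.Vertex |
      ∃ s ∈ X.faces, Function.support (x : X.Vertex → ℝ) ⊆ s} := by
    have : {x : stdSimplex ℝ X.Vertex |
        ∃ s ∈ X.faces, Function.support (x : X.Vertex → ℝ) ⊆ s} =
        ⋃ s ∈ X.faces, ⋂ v ∈ {v | v ∉ s}, {x : stdSimplex ℝ X.Vertex | x.1 v = 0} := by
      ext x
      simp only [Set.mem_ofPred_eq, Set.mem_iUnion, Set.mem_iInter, exists_prop]
      refine exists_congr fun s => and_congr_right fun _ => ?_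
      exact ⟨fun h v hv => by_contra fun hne => hv (h hne), fun h v hv => by_contra fun hs =>
        hv (h v hs)⟩
    rw [this]
    refine (Set.toFinite _).isClosed_biUnion fun s _ => isClosed_biInter fun v _ => ?_
    exact isClosed_eq ((continuous_apply v).comp continuous_subtype_val) continuous_const
  exact isCompact_iff_compactSpace.1 hcl.isCompact

/-- Two points lie in a common closed simplex. -/
def InCommonFace (x y : X.Realization) : Prop :=
  ∃ s ∈ X.faces, ∀ v, x.coord v ≠ 0 ∨ y.coord v ≠ 0 → v ∈ s

theorem inCommonFace_of_imp {x y : X.Realization} (h : ∀ v, y.coord v ≠ 0 → x.coord v ≠ 0) :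
    InCommonFace x y :=
  let ⟨s, hs, hsx⟩ := x.exists_face
  ⟨s, hs, fun v hv => hsx v (hv.elim id (h v))⟩

/-- The straight line between two points in a common closed simplex. -/
def linePoint (x y : X.Realization) (h : InCommonFace x y) (t : I) : X.Realization :=
  mk (fun v => (1 - (t : ℝ)) * x.coord v + t * y.coord v)
    (fun v => add_nonneg (mul_nonneg (by linarith [t.2.2]) (x.coord_nonneg v))
      (mul_nonneg t.2.1 (y.coord_nonneg v)))
    (by rw [Finset.sum_add_distrib, ← Finset.mul_sum, ← Finset.mul_sum, x.sum_coord, y.sum_coord]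
        ring)
    (by
      obtain ⟨s, hs, hsv⟩ := h
      refine ⟨s, hs, fun v hv => hsv v ?_⟩
      by_contra! hc
      simp [hc] at hv)

@[simp]
theorem coord_linePoint (x y : X.Realization) (h : InCommonFace x y) (t : I) (v : X.Vertex) :
    (linePoint x y h t).coord v = (1 - (t : ℝ)) * x.coord v + t * y.coord v := rfl

/-- The straight path between two points in a common closed simplex. -/
def linePath (x y : X.Realization) (h : InCommonFace x y) : Path x y where
  toFun := linePoint x y h
  continuous_toFun := continuous_iff.2 fun v => by
    simp only [coord_linePoint]
    fun_prop
  source' := ext fun v => by simp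
  target' := ext fun v => by simp

@[simp]
theorem linePath_apply (x y : X.Realization) (h : InCommonFace x y) (t : I) :
    linePath x y h t = linePoint x y h t := rfl

/-- Interpolating linearly between `γ t` and `γ' t` at each time fills a square whose remaining
sides are the straight lines at the endpoints. -/
theorem homotopic_of_inCommonFace {a b c d : X.Realization} (γ : Path a b) (γ' : Path c d)
    (h : ∀ t, InCommonFace (γ t) (γ' t)) (hac : InCommonFace a c) (hbd : InCommonFace b d) :
    (γ.trans (linePath b d hbd)).Homotopic ((linePath a c hac).trans γ') := by
  refine homotopic_of_square (fun st => linePoint (γ st.2) (γ' st.2) (h st.2) st.1) ?_ _ _ _ _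
    (fun t => ?_) (fun t => ?_) (fun t => ?_) (fun t => ?_)
  · refine continuous_iff.2 fun v => ?_
    simp only [coord_linePoint]
    have h1 := (continuous_coord v).comp γ.continuous
    have h2 := (continuous_coord v).comp γ'.continuous
    have h3 : Continuous fun st : I × I => (st.1 : ℝ) := continuous_subtype_val.comp continuous_fst
    exact ((continuous_const.sub h3).mul (h1.comp continuous_snd)).add
      (h3.mul (h2.comp continuous_snd))
  · exact ext fun v => by simp
  · exact ext fun v => by simp
  · exact ext fun v => by simp
  · exact ext fun v => by simp

end Realization

open Realization

/-! ### Retracting star preimages onto fibres -/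

theorem SimplicialMap.coord_realize (f : SimplicialMap X P) [DecidableEq P.Vertex]
    (x : X.Realization) (c : P.Vertex) :
    (f.realize x).coord c = ∑ v with f.toFun v = c, x.coord v := by
  change (stdSimplex.map f.toFun x.1) c = _
  rw [stdSimplex.map_coe, FunOnFinite.linearMap_apply_apply]
  refine Finset.sum_congr ?_ fun _ _ => rfl
  ext
  simp

theorem SimplicialMap.coord_realize_ne_zero_of (f : SimplicialMap X P) {x : X.Realization}
    {v : X.Vertex} (hv : x.coord v ≠ 0) : (f.realize x).coord (f.toFun v) ≠ 0 := by
  classical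
  rw [f.coord_realize]
  refine (Finset.sum_pos' (fun _ _ => x.coord_nonneg _) ⟨v, by simp, ?_⟩).ne'
  exact lt_of_le_of_ne (x.coord_nonneg v) hv.symm

theorem SimplicialMap.continuous_coord_realize (f : SimplicialMap X P) (c : P.Vertex) :
    Continuous fun x : X.Realization => (f.realize x).coord c := by
  classical
  simp only [f.coord_realize]
  exact continuous_finsetSum _ fun v _ => continuous_coord v

/-- The points whose image has positive coordinates wherever `p` has. -/
def SimplicialMap.starPreimage (f : SimplicialMap X P) (p : P.Realization) :
    Set X.Realization :=
  {x | ∀ c, p.coord c ≠ 0 → (f.realize x).coord c ≠ 0}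

/-- Rescaling barycentric coordinates retracts the preimage of a star onto a fibre. -/
noncomputable def SimplicialMap.toFibre (f : SimplicialMap X P) (p : P.Realization)
    (x : X.Realization) (hx : x ∈ f.starPreimage p) : X.Realization :=
  Realization.mk (fun v => p.coord (f.toFun v) * x.coord v / (f.realize x).coord (f.toFun v))
    (fun v => div_nonneg (mul_nonneg (p.coord_nonneg _) (x.coord_nonneg _)) (coord_nonneg _ _))
    (by
      classical
      -- Over each vertex `c` of `P` the coordinates of `x` add up to `f(x)_c`, so the rescaled ones
      -- add up to `p_c`.
      rw [← Finset.sum_fiberwise (s := Finset.univ) (g := f.toFun), ← p.sum_coord]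
      refine Finset.sum_congr rfl fun c _ => ?_
      rw [Finset.sum_congr rfl (g := fun v => p.coord c / (f.realize x).coord c * x.coord v)
        fun v hv => by rw [(Finset.mem_filter.1 hv).2]; ring, ← Finset.mul_sum,
        ← f.coord_realize]
      by_cases hc : p.coord c = 0
      · simp [hc]
      · exact div_mul_cancel₀ _ (hx c hc))
    (by
      obtain ⟨s, hs, hsx⟩ := x.exists_face
      refine ⟨s, hs, fun v hv => hsx v ?_⟩
      intro h0
      simp [h0] at hv)

theorem SimplicialMap.coord_toFibre (f : SimplicialMap X P) (p : P.Realization)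
    (x : X.Realization) (hx : x ∈ f.starPreimage p) (v : X.Vertex) :
    (f.toFibre p x hx).coord v =
      p.coord (f.toFun v) * x.coord v / (f.realize x).coord (f.toFun v) := rfl

/-- Rescaling creates no new nonzero coordinates. -/
theorem SimplicialMap.inCommonFace_toFibre (f : SimplicialMap X P) (p : P.Realization)
    (x : X.Realization) (hx : x ∈ f.starPreimage p) : InCommonFace x (f.toFibre p x hx) :=
  inCommonFace_of_imp fun v hv h0 => by simp [coord_toFibre, h0] at hv

theorem SimplicialMap.realize_toFibre (f : SimplicialMap X P) (p : P.Realization)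
    (x : X.Realization) (hx : x ∈ f.starPreimage p) : f.realize (f.toFibre p x hx) = p := by
  classical
  refine ext fun c => ?_
  rw [f.coord_realize, Finset.sum_congr rfl
    (g := fun v => p.coord c / (f.realize x).coord c * x.coord v)
    fun v hv => by rw [coord_toFibre, (Finset.mem_filter.1 hv).2]; ring, ← Finset.mul_sum,
    ← f.coord_realize]
  by_cases hc : p.coord c = 0
  · simp [hc]
  · exact div_mul_cancel₀ _ (hx c hc)

theorem SimplicialMap.coord_realize_linePoint (f : SimplicialMap X P) {x y : X.Realization}
    (h : InCommonFace x y) (t : I) (c : P.Vertex) :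
    (f.realize (linePoint x y h t)).coord c =
      (1 - (t : ℝ)) * (f.realize x).coord c + t * (f.realize y).coord c := by
  classical
  simp only [f.coord_realize, coord_linePoint, Finset.sum_add_distrib, Finset.mul_sum]

theorem SimplicialMap.exists_loop_toFibre (f : SimplicialMap X P) (p : P.Realization)
    {x : X.Realization} (hx : x ∈ f.starPreimage p) (γ : Path x x)
    (hγ : ∀ t, γ t ∈ f.starPreimage p) :
    ∃ γ' : Path (f.toFibre p x hx) (f.toFibre p x hx), (∀ t, γ' t ∈ f.realize ⁻¹' {p}) ∧
      (γ.trans (linePath _ _ (f.inCommonFace_toFibre p x hx))).Homotopic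
        ((linePath _ _ (f.inCommonFace_toFibre p x hx)).trans γ') := by
  let γ' : Path (f.toFibre p x hx) (f.toFibre p x hx) :=
    { toFun := fun t => f.toFibre p (γ t) (hγ t)
      continuous_toFun := by
        refine continuous_iff.2 fun v => ?_
        simp only [coord_toFibre]
        -- The denominator can vanish only where `p` does, and there the coordinate is constantly
        -- zero.
        by_cases hv : p.coord (f.toFun v) = 0
        · simpa [hv] using continuous_const
        · exact (continuous_const.mul ((continuous_coord v).comp γ.continuous)).div
            ((f.continuous_coord_realize _).comp γ.continuous) fun t => hγ t _ hv
      source' := by simp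
      target' := by simp }
  exact ⟨γ', fun t => f.realize_toFibre p _ (hγ t),
    homotopic_of_inCommonFace γ γ' (fun t => f.inCommonFace_toFibre p _ (hγ t)) _ _⟩

/-- Stated for any `V` between the fibre and the star preimage that contains the retraction lines,
so that it serves both the full star preimage and the smaller preimage of a barycentric star. -/
theorem SimplicialMap.loopSubgroup_map_eq_fibre (f : SimplicialMap X P) (p : P.Realization)
    {V : Set X.Realization} (hV : V ⊆ f.starPreimage p) (hfib : f.realize ⁻¹' {p} ⊆ V)
    (hline : ∀ x (hx : x ∈ V) t,
      linePoint _ _ (f.inCommonFace_toFibre p x (hV hx)) t ∈ V)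
    {x : X.Realization} (hx : x ∈ V) :
    (loopSubgroup V x hx).map (FundamentalGroup.fundamentalGroupMulEquivOfPath
      (linePath _ _ (f.inCommonFace_toFibre p x (hV hx)))).toMonoidHom =
      loopSubgroup (f.realize ⁻¹' {p}) (f.toFibre p x (hV hx)) (f.realize_toFibre p _ _) :=
  loopSubgroup_map_eq _ hx _ hfib (hline x hx) fun γ hγ =>
    f.exists_loop_toFibre p (hV hx) γ fun t => hV (hγ t)

end FiniteSimplicialComplex

/-! ### Open stars, and finite generation for fibres -/

namespace FiniteSimplicialComplex

variable {X P : FiniteSimplicialComplex.{u}}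

namespace Realization

/-- The barycentre of a simplex. -/
noncomputable def barycentre (s : Finset X.Vertex) (hs : s ∈ X.faces) : X.Realization :=
  mk ((s : Set X.Vertex).indicator fun _ => (s.card : ℝ)⁻¹)
    (fun _ => Set.indicator_nonneg (fun _ _ => by positivity) _)
    (by
      classical
      simp only [Set.indicator_apply, Finset.mem_coe, Finset.sum_ite_mem, Finset.univ_inter,
        Finset.sum_const, nsmul_eq_mul]
      exact mul_inv_cancel₀ (Nat.cast_ne_zero.2 (Finset.card_pos.2 (faces_nonempty hs)).ne'))
    ⟨s, hs, fun _ hv => Set.mem_of_indicator_ne_zero hv⟩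

theorem coord_barycentre_of_mem {s : Finset X.Vertex} (hs : s ∈ X.faces) {v : X.Vertex}
    (hv : v ∈ s) : (barycentre s hs).coord v = (s.card : ℝ)⁻¹ := by
  simp [barycentre, hv]

theorem coord_barycentre_of_notMem {s : Finset X.Vertex} (hs : s ∈ X.faces) {v : X.Vertex}
    (hv : v ∉ s) : (barycentre s hs).coord v = 0 := by
  simp [barycentre, hv]

theorem coord_barycentre_pos {s : Finset X.Vertex} (hs : s ∈ X.faces) {v : X.Vertex}
    (hv : v ∈ s) : 0 < (barycentre s hs).coord v := by
  rw [coord_barycentre_of_mem hs hv]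
  exact inv_pos.2 (Nat.cast_pos.2 (Finset.card_pos.2 (faces_nonempty hs)))

theorem coord_barycentre_ne_zero_iff {s : Finset X.Vertex} (hs : s ∈ X.faces) {v : X.Vertex} :
    (barycentre s hs).coord v ≠ 0 ↔ v ∈ s :=
  ⟨fun h => by_contra fun hv => h (coord_barycentre_of_notMem hs hv),
    fun hv => (coord_barycentre_pos hs hv).ne'⟩

/-- The open star of a set of vertices. -/
def openStar (s : Finset X.Vertex) : Set X.Realization := {x | ∀ v ∈ s, x.coord v ≠ 0}

theorem isOpen_openStar (s : Finset X.Vertex) : IsOpen (openStar s) := by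
  have : openStar s = ⋂ v ∈ s, {x : X.Realization | x.coord v ≠ 0} := by
    ext x
    simp [openStar]
  rw [this]
  exact isOpen_biInter_finset fun v _ => isOpen_ne_fun (continuous_coord v) continuous_const

theorem mem_faces_of_mem_openStar {s : Finset X.Vertex} (hs : s.Nonempty) {x : X.Realization}
    (hx : x ∈ openStar s) : s ∈ X.faces := x.mem_faces hs hx

theorem inCommonFace_barycentre {s : Finset X.Vertex} (hs : s ∈ X.faces) {x : X.Realization}
    (hx : x ∈ openStar s) : InCommonFace x (barycentre s hs) :=
  inCommonFace_of_imp fun v hv => hx v ((coord_barycentre_ne_zero_iff hs).1 hv)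

theorem linePoint_barycentre_mem_openStar {s : Finset X.Vertex} (hs : s ∈ X.faces)
    {x : X.Realization} (hx : x ∈ openStar s) (t : I) :
    linePoint x _ (inCommonFace_barycentre hs hx) t ∈ openStar s := by
  intro v hv
  rw [coord_linePoint]
  have h1 : 0 < x.coord v := lt_of_le_of_ne (x.coord_nonneg v) (hx v hv).symm
  have h2 := coord_barycentre_pos hs hv
  have h3 := t.2.1
  have h4 := t.2.2
  refine ne_of_gt ?_
  rcases h3.eq_or_lt with h | h
  · simp [← h, h1]
  · exact add_pos_of_nonneg_of_pos (mul_nonneg (by linarith) h1.le) (mul_pos h h2)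

/-- Contracting the star linearly to the barycentre shows that every path in it is homotopic to the
one going straight to the barycentre and straight back out. -/
theorem homotopic_of_mem_openStar {s : Finset X.Vertex} (hs : s.Nonempty) {x y : X.Realization}
    (p q : Path x y) (hp : ∀ t, p t ∈ openStar s) (hq : ∀ t, q t ∈ openStar s) :
    p.Homotopic q := by
  have hx : x ∈ openStar s := p.source ▸ hp 0
  have hy : y ∈ openStar s := p.target ▸ hp 1
  have hs' := mem_faces_of_mem_openStar hs hx
  have key : ∀ r : Path x y, (∀ t, r t ∈ openStar s) → Path.Homotopic.Quotient.mk r =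
      (Path.Homotopic.Quotient.mk (linePath x _ (inCommonFace_barycentre hs' hx))).trans
        (Path.Homotopic.Quotient.mk (linePath y _ (inCommonFace_barycentre hs' hy))).symm := by
    intro r hr
    have h := Path.Homotopic.Quotient.eq.2 (homotopic_of_inCommonFace r
      (Path.refl (barycentre s hs')) (fun t => inCommonFace_barycentre hs' (hr t))
      (inCommonFace_barycentre hs' hx) (inCommonFace_barycentre hs' hy))
    rw [Path.Homotopic.Quotient.mk_trans, Path.Homotopic.Quotient.mk_trans,
      Path.Homotopic.Quotient.mk_refl, Path.Homotopic.Quotient.trans_refl] at h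
    rw [← h, Path.Homotopic.Quotient.trans_assoc, Path.Homotopic.Quotient.trans_symm,
      Path.Homotopic.Quotient.trans_refl]
  exact Path.Homotopic.Quotient.eq.1 ((key p hp).trans (key q hq).symm)

theorem exists_path_openStar {s : Finset X.Vertex} (hs : s.Nonempty) {x y : X.Realization}
    (hx : x ∈ openStar s) (hy : y ∈ openStar s) : ∃ p : Path x y, ∀ t, p t ∈ openStar s := by
  have hs' := mem_faces_of_mem_openStar hs hx
  refine ⟨(linePath x _ (inCommonFace_barycentre hs' hx)).trans
    (linePath y _ (inCommonFace_barycentre hs' hy)).symm, fun t => ?_⟩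
  rw [Path.trans_apply]
  split_ifs
  · exact linePoint_barycentre_mem_openStar hs' hx _
  · exact linePoint_barycentre_mem_openStar hs' hy _

end Realization

open Realization

theorem SimplicialMap.starPreimage_eq_iUnion (f : SimplicialMap X P) (p : P.Realization) :
    f.starPreimage p = ⋃ s : {s : Finset X.Vertex // ∀ c, p.coord c ≠ 0 → ∃ v ∈ s, f.toFun v = c},
      openStar s.1 := by
  classical
  ext x
  rw [Set.mem_iUnion]
  constructor
  · intro hx
    -- The support of `x` meets the preimage of every vertex at which `p` is nonzero.
    refine ⟨⟨Finset.univ.filter fun v => x.coord v ≠ 0, fun c hc => ?_⟩, fun v hv => by simpa using hv⟩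
    have := hx c hc
    rw [f.coord_realize] at this
    obtain ⟨v, hv, hxv⟩ := Finset.exists_ne_zero_of_sum_ne_zero this
    exact ⟨v, by simpa using hxv, by simpa using hv⟩
  · rintro ⟨⟨s, hs⟩, hx⟩ c hc
    obtain ⟨v, hv, rfl⟩ := hs c hc
    exact f.coord_realize_ne_zero_of (hx v hv)

/-- The loops in the preimage of a star generate a finitely generated subgroup. -/
theorem SimplicialMap.fg_loopSubgroup_starPreimage (f : SimplicialMap X P) (p : P.Realization)
    {x : X.Realization} (hx : x ∈ f.starPreimage p) :
    (loopSubgroup (f.starPreimage p) x hx).FG := by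
  classical
  -- Nonemptiness matters: the open star of the empty set is the whole realisation.
  have hne : ∀ s : {s : Finset X.Vertex // ∀ c, p.coord c ≠ 0 → ∃ v ∈ s, f.toFun v = c},
      s.1.Nonempty := fun s =>
    let ⟨c, hc⟩ := p.exists_coord_ne_zero
    let ⟨v, hv, _⟩ := s.2 c hc
    ⟨v, hv⟩
  refine fg_loopSubgroup_iUnion (fun s => isOpen_openStar s.1)
    (fun s x y p q hp hq => homotopic_of_mem_openStar (hne s) p q hp hq)
    (fun s t x y hxs hys hxt hyt => ?_) (f.starPreimage_eq_iUnion p) x hx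
  -- The intersection of two open stars is the open star of the union.
  have hmem : ∀ z, z ∈ openStar (s.1 ∪ t.1) ↔ z ∈ openStar s.1 ∧ z ∈ openStar t.1 := fun z => by
    simp only [openStar, Set.mem_ofPred_eq, Finset.mem_union]
    exact ⟨fun h => ⟨fun v hv => h v (Or.inl hv), fun v hv => h v (Or.inr hv)⟩,
      fun h v hv => hv.elim (h.1 v) (h.2 v)⟩
  obtain ⟨γ, hγ⟩ := exists_path_openStar ((hne s).mono Finset.subset_union_left)
    ((hmem x).2 ⟨hxs, hxt⟩) ((hmem y).2 ⟨hys, hyt⟩)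
  exact ⟨γ, fun t => (hmem _).1 (hγ t)⟩

theorem SimplicialMap.fibre_subset_starPreimage (f : SimplicialMap X P) (p : P.Realization) :
    f.realize ⁻¹' {p} ⊆ f.starPreimage p := by
  rintro x rfl c hc
  exact hc

/-- On the fibre over `p` all relevant scaling factors are 1. -/
theorem SimplicialMap.toFibre_of_mem_fibre (f : SimplicialMap X P) {p : P.Realization}
    {x : X.Realization} (hx : f.realize x = p) (h : x ∈ f.starPreimage p) :
    f.toFibre p x h = x := by
  refine ext fun v => ?_
  rw [coord_toFibre, hx]
  by_cases hv : p.coord (f.toFun v) = 0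
  · have : x.coord v = 0 := by
      by_contra hne
      exact f.coord_realize_ne_zero_of hne (hx ▸ hv)
    simp [this]
  · rw [mul_comm, mul_div_assoc, div_self hv, mul_one]

theorem SimplicialMap.fg_loopSubgroup_fibre (f : SimplicialMap X P) (p : P.Realization)
    {x : X.Realization} (hx : x ∈ f.realize ⁻¹' {p}) :
    (loopSubgroup (f.realize ⁻¹' {p}) x hx).FG := by
  have hx' := f.fibre_subset_starPreimage p hx
  have h := f.loopSubgroup_map_eq_fibre p (le_refl _) (f.fibre_subset_starPreimage p)
    (fun y hy t c hc => ?_) hx'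
  · have hfg : (loopSubgroup (f.realize ⁻¹' {p}) _ (f.realize_toFibre p x hx')).FG := by
      rw [← h]
      exact (f.fg_loopSubgroup_starPreimage p hx').of_mulEquiv
        (Subgroup.equivMapOfInjective _ _ (MulEquiv.injective _))
    have e := f.toFibre_of_mem_fibre hx hx'
    have : ∀ y (hy : y ∈ f.realize ⁻¹' {p}), y = x →
        (loopSubgroup (f.realize ⁻¹' {p}) y hy).FG →
        (loopSubgroup (f.realize ⁻¹' {p}) x hx).FG := by
      rintro _ _ rfl h
      exact h
    exact this _ _ e hfg
  · rw [f.coord_realize_linePoint, f.realize_toFibre]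
    have h1 : 0 < p.coord c := lt_of_le_of_ne (p.coord_nonneg c) hc.symm
    have h2 : 0 < (f.realize y).coord c := lt_of_le_of_ne (coord_nonneg _ c) (hy c hc).symm
    have h3 := t.2.1
    have h4 := t.2.2
    refine ne_of_gt ?_
    rcases h3.eq_or_lt with h | h
    · simp [← h, h2]
    · exact add_pos_of_nonneg_of_pos (mul_nonneg (by linarith) h2.le) (mul_pos h h1)

/-! ### From fibre collapsing to open covers -/

/-- The open star, in the barycentric subdivision, of the barycentre of a simplex. -/
def barycentricStar (s : Finset X.Vertex) : Set X.Realization :=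
  {x | (∀ v ∈ s, 0 < x.coord v) ∧ ∀ v ∈ s, ∀ w ∉ s, x.coord w < x.coord v}

theorem isOpen_preimage_barycentricStar (f : SimplicialMap X P) (s : Finset P.Vertex) :
    IsOpen (f.realize ⁻¹' barycentricStar s) := by
  have : f.realize ⁻¹' barycentricStar s =
      (⋂ v ∈ {v | v ∈ s}, {x | 0 < (f.realize x).coord v}) ∩ ⋂ v ∈ {v | v ∈ s}, ⋂ w ∈ {w | w ∉ s},
        {x | (f.realize x).coord w < (f.realize x).coord v} := by
    ext x
    simp [barycentricStar]
  rw [this]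
  refine IsOpen.inter ((Set.toFinite _).isOpen_biInter fun v _ => ?_)
    ((Set.toFinite _).isOpen_biInter fun v _ => (Set.toFinite _).isOpen_biInter fun w _ => ?_)
  · exact isOpen_lt continuous_const (f.continuous_coord_realize v)
  · exact isOpen_lt (f.continuous_coord_realize w) (f.continuous_coord_realize v)

/-- Each of the two sets has a vertex outside the other; a common point would have to order these
two coordinates both ways. -/
theorem disjoint_barycentricStar {s t : Finset X.Vertex} (hne : s ≠ t) (hcard : s.card = t.card) :
    Disjoint (barycentricStar s) (barycentricStar t) := by
  rw [Set.disjoint_left]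
  rintro x hs ht
  obtain ⟨v, hvs, hvt⟩ := Finset.not_subset.1 fun h => hne (Finset.eq_of_subset_of_card_le h hcard.ge)
  obtain ⟨w, hwt, hws⟩ := Finset.not_subset.1 fun h =>
    hne (Finset.eq_of_subset_of_card_le h hcard.le).symm
  exact lt_asymm (hs.2 v hvs w hws) (ht.2 w hwt v hvt)

/-- Take the vertices at which the coordinate of `x` is maximal. -/
theorem exists_mem_barycentricStar (x : X.Realization) :
    ∃ s ∈ X.faces, x ∈ barycentricStar s := by
  classical
  obtain ⟨v₀, hv₀⟩ := x.exists_coord_ne_zero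
  obtain ⟨v₁, -, hv₁⟩ := Finset.exists_max_image Finset.univ x.coord ⟨v₀, Finset.mem_univ _⟩
  have hpos : 0 < x.coord v₁ :=
    (lt_of_le_of_ne (x.coord_nonneg v₀) hv₀.symm).trans_le (hv₁ v₀ (Finset.mem_univ _))
  let s := Finset.univ.filter fun v => x.coord v = x.coord v₁
  have hs : ∀ v, v ∈ s ↔ x.coord v = x.coord v₁ := fun v => by simp [s]
  refine ⟨s, x.mem_faces ⟨v₁, (hs _).2 rfl⟩ fun v hv => ?_, fun v hv => ?_, fun v hv w hw => ?_⟩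
  · rw [(hs v).1 hv]
    exact hpos.ne'
  · rwa [(hs v).1 hv]
  · rw [(hs v).1 hv]
    exact lt_of_le_of_ne (hv₁ w (Finset.mem_univ _)) fun h => hw ((hs w).2 h)

/-- The strict inequalities defining the star also hold at the barycentre and survive convex
combinations, so the preimage retracts along straight lines onto the fibre over the barycentre, and
the two groups are conjugate. -/
theorem isGSet_preimage_barycentricStar {𝒢 : GroupClass.{u}} (hiso : 𝒢.ClosedUnderIso)
    (f : SimplicialMap X P) {s : Finset P.Vertex} (hs : s ∈ P.faces)
    (hf : ∀ p : P.Realization, IsGSet 𝒢 (f.realize ⁻¹' {p})) :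
    IsGSet 𝒢 (f.realize ⁻¹' barycentricStar s) := by
  rw [isGSet_iff]
  intro x hx
  have hV : f.realize ⁻¹' barycentricStar s ⊆ f.starPreimage (barycentre s hs) :=
    fun y hy c hc => (hy.1 c ((coord_barycentre_ne_zero_iff hs).1 hc)).ne'
  have hb : ∀ v ∈ s, ∀ w ∉ s, (barycentre s hs).coord w < (barycentre s hs).coord v :=
    fun v hv w hw => by
      rw [coord_barycentre_of_notMem hs hw]
      exact coord_barycentre_pos hs hv
  have h := f.loopSubgroup_map_eq_fibre (barycentre s hs) hV ?_ ?_ hx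
  · have e := (loopSubgroup _ x hx).equivMapOfInjective
      (FundamentalGroup.fundamentalGroupMulEquivOfPath
        (linePath _ _ (f.inCommonFace_toFibre _ x (hV hx)))).toMonoidHom (MulEquiv.injective _)
    refine hiso _ _ ⟨e.symm⟩ ?_
    rw [h]
    exact isGSet_iff.1 (hf (barycentre s hs)) _ _
  · intro y (hy : f.realize y = _)
    change f.realize y ∈ barycentricStar s
    rw [hy]
    exact ⟨fun v hv => coord_barycentre_pos hs hv, hb⟩
  · intro y hy t
    have h3 := t.2.1
    have h4 := t.2.2
    have aux : ∀ a b c d : ℝ, a < c → b < d →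
        (1 - (t : ℝ)) * a + t * b < (1 - (t : ℝ)) * c + t * d := fun a b c d hac hbd => by
      rcases h3.eq_or_lt with h | h
      · simpa [← h] using hac
      · exact add_lt_add_of_le_of_lt (mul_le_mul_of_nonneg_left hac.le (by linarith))
          (mul_lt_mul_of_pos_left hbd h)
    refine ⟨fun v hv => ?_, fun v hv w hw => ?_⟩
    · rw [f.coord_realize_linePoint, f.realize_toFibre]
      simpa using aux 0 0 _ _ (hy.1 v hv) (coord_barycentre_pos hs hv)
    · rw [f.coord_realize_linePoint, f.coord_realize_linePoint, f.realize_toFibre]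
      exact aux _ _ _ _ (hy.2 v hv w hw) (hb v hv w hw)

theorem card_le_of_dim_le {k : ℕ} (h : X.dim ≤ (k : WithBot ℕ∞)) {s : Finset X.Vertex}
    (hs : s ∈ X.faces) : s.card ≤ k + 1 := by
  have h1 : (((s.card - 1 : ℕ) : ℕ∞) : WithBot ℕ∞) ≤ (k : WithBot ℕ∞) :=
    (le_iSup₂ (f := fun (s : Finset X.Vertex) (_ : s ∈ X.faces) =>
      (((s.card - 1 : ℕ) : ℕ∞) : WithBot ℕ∞)) s hs).trans h
  have h2 : s.card - 1 ≤ k := by exact_mod_cast h1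
  omega

theorem FibreCollapsing.gCat_le {𝒢 : GroupClass.{u}} (hiso : 𝒢.ClosedUnderIso) {k : ℕ}
    (h : X.FibreCollapsing 𝒢 k) : gCat 𝒢 X.Realization ≤ (k : ℕ∞) + 1 := by
  obtain ⟨P, f, hdim, hf⟩ := h
  -- One open set per dimension: simplices of dimension `i` have `i + 1` vertices.
  let U : Fin (k + 1) → Set X.Realization := fun i =>
    ⋃ s : {s : Finset P.Vertex // s ∈ P.faces ∧ s.card = i + 1}, f.realize ⁻¹' barycentricStar s.1
  have hU : IsOpenGCover 𝒢 (Set.range U) := by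
    refine ⟨?_, ?_, ?_⟩
    · rintro _ ⟨i, rfl⟩
      exact isOpen_iUnion fun s => isOpen_preimage_barycentricStar f s.1
    · rintro _ ⟨i, rfl⟩
      refine IsGSet.iUnion_of_pairwise_disjoint (fun s => isOpen_preimage_barycentricStar f s.1)
        (fun s t hst => ?_) fun s => isGSet_preimage_barycentricStar hiso f s.2.1 hf
      exact (disjoint_barycentricStar (fun h => hst (Subtype.ext h))
        (s.2.2.trans t.2.2.symm)).preimage _
    · refine Set.eq_univ_of_forall fun x => ?_
      obtain ⟨s, hs, hxs⟩ := exists_mem_barycentricStar (f.realize x)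
      have h1 := card_le_of_dim_le hdim hs
      have h2 := Finset.card_pos.2 (faces_nonempty hs)
      exact Set.mem_sUnion.2 ⟨_, ⟨⟨s.card - 1, by omega⟩, rfl⟩,
        Set.mem_iUnion.2 ⟨⟨s, hs, by simp only; omega⟩, hxs⟩⟩
  have h1 : gCat 𝒢 X.Realization ≤ (Set.range U).encard :=
    sInf_le ⟨_, Set.finite_range U, hU, rfl⟩
  refine h1.trans ?_
  rw [← Set.image_univ]
  refine (Set.encard_image_le _ _).trans ?_
  simp [Set.encard_univ]

end FiniteSimplicialComplex

/-! ### From colourings to fibre collapsing -/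

namespace FiniteSimplicialComplex

open Realization

/-- The full simplex on a finite set of vertices. -/
def fullSimplex (ι : Type u) [Fintype ι] : FiniteSimplicialComplex.{u} where
  Vertex := ι
  complex :=
    { faces := {s | s.Nonempty}
      isRelLowerSet_faces := fun _ hs => ⟨hs, fun _ _ ht => ht⟩
      singleton_mem := fun v => Finset.singleton_nonempty v }

theorem dim_fullSimplex_le {ι : Type u} [Fintype ι] {k : ℕ} (h : Fintype.card ι ≤ k + 1) :
    (fullSimplex ι).dim ≤ (k : WithBot ℕ∞) := by
  refine iSup₂_le fun s _ => ?_
  have h1 : s.card ≤ Fintype.card ι := Finset.card_le_univ s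
  have h2 : s.card - 1 ≤ k := by omega
  exact_mod_cast h2

/-- A colouring of the vertices is a simplicial map to the full simplex on the colours. -/
noncomputable def colourMap {X : FiniteSimplicialComplex.{u}} {ι : Type u} [Fintype ι]
    (c : X.Vertex → ι) : SimplicialMap X (fullSimplex ι) where
  toFun := c
  image_mem_faces s hs := by
    classical
    exact ⟨s.image c, (faces_nonempty hs).image c, Finset.coe_image⟩

theorem fibreCollapsing_of_colouring {X : FiniteSimplicialComplex.{u}} {𝒢 : GroupClass.{u}}
    (hiso : 𝒢.ClosedUnderIso) {k : ℕ} {ι : Type u} [Fintype ι] (hcard : Fintype.card ι ≤ k + 1)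
    {U : ι → Set X.Realization} (hU : ∀ i, IsGSet 𝒢.closure (U i)) (c : X.Vertex → ι)
    (hc : ∀ v, openStar {v} ⊆ U (c v)) : X.FibreCollapsing 𝒢 k := by
  let f : SimplicialMap X (fullSimplex ι) := colourMap c
  refine ⟨fullSimplex ι, f, dim_fullSimplex_le hcard, fun p => isGSet_iff.2 fun x hx => ?_⟩
  -- Any colour present in `p` will do: the fibre over `p` is pushed into the fibre over that vertex
  -- `q`.
  obtain ⟨i, hi⟩ := p.exists_coord_ne_zero
  have hs : ({i} : Finset (fullSimplex ι).Vertex) ∈ (fullSimplex ι).faces :=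
    Finset.singleton_nonempty i
  let q := barycentre {i} hs
  have hfib : f.realize ⁻¹' {p} ⊆ f.starPreimage q := by
    rintro y rfl j hj
    rw [Finset.mem_singleton.1 ((coord_barycentre_ne_zero_iff hs).1 hj)]
    exact hi
  -- A point over `q` has only vertices of colour `i` in its support, hence lies in the open star of
  -- such a vertex.
  have hq : f.realize ⁻¹' {q} ⊆ U i := by
    intro y (hy : f.realize y = q)
    obtain ⟨v, hv⟩ := y.exists_coord_ne_zero
    have h1 := f.coord_realize_ne_zero_of hv
    rw [hy] at h1
    have h2 : c v = i := Finset.mem_singleton.1 ((coord_barycentre_ne_zero_iff hs).1 h1)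
    rw [← h2]
    refine hc v fun w hw => ?_
    rwa [Finset.mem_singleton.1 hw]
  refine GroupClass.of_fg_of_map_le hiso _ (f.fg_loopSubgroup_fibre p hx)
    (loopSubgroup_map_le (linePath _ _ (f.inCommonFace_toFibre q x (hfib hx))) hx
      (hq (f.realize_toFibre q x (hfib hx))) fun γ hγ => ?_)
    (isGSet_iff.1 (hU i) _ _)
  obtain ⟨γ', hγ', h⟩ := f.exists_loop_toFibre q (hfib hx) γ fun t => hfib (hγ t)
  exact ⟨γ', fun t => hq (hγ' t), h⟩

/-! ### The homeomorphism from the barycentric subdivision -/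

section Subdivision

variable {X : FiniteSimplicialComplex.{u}}

/-- The simplex of `X` that a vertex of the barycentric subdivision stands for. -/
def toFace (s : X.barycentricSubdivision.Vertex) : Finset X.Vertex :=
  Subtype.val (p := fun s => s ∈ X.faces) s

theorem toFace_mem (s : X.barycentricSubdivision.Vertex) : toFace s ∈ X.faces :=
  Subtype.property (p := fun s => s ∈ X.faces) s

theorem toFace_injective : Function.Injective (toFace (X := X)) :=
  Subtype.val_injective (p := fun s => s ∈ X.faces)

theorem exists_toFace_eq {s : Finset X.Vertex} (hs : s ∈ X.faces) :
    ∃ a : X.barycentricSubdivision.Vertex, toFace a = s := ⟨⟨s, hs⟩, rfl⟩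

theorem mem_faces_barycentricSubdivision_iff {c : Finset X.barycentricSubdivision.Vertex} :
    c ∈ X.barycentricSubdivision.faces ↔ c.Nonempty ∧
      ∀ s ∈ c, ∀ t ∈ c, toFace s ⊆ toFace t ∨ toFace t ⊆ toFace s := by
  refine and_congr_right fun _ => ⟨fun h s hs t ht => ?_, fun h s hs t ht _ => h s hs t ht⟩
  exact IsChain.total (r := fun s t : {s : Finset X.Vertex // s ∈ X.faces} => s ≤ t) h hs ht

theorem toFace_chain (x : X.barycentricSubdivision.Realization)
    {s t : X.barycentricSubdivision.Vertex} (hs : x.coord s ≠ 0) (ht : x.coord t ≠ 0) :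
    toFace s ⊆ toFace t ∨ toFace t ⊆ toFace s :=
  let ⟨_, hc, hcx⟩ := x.exists_face
  (mem_faces_barycentricSubdivision_iff.1 hc).2 s (hcx s hs) t (hcx t ht)

/-- The affine extension of the map that sends a simplex to its barycentre. -/
noncomputable def subdivisionMap (x : X.barycentricSubdivision.Realization) : X.Realization :=
  Realization.mk (fun v => ∑ s, x.coord s * (barycentre (toFace s) (toFace_mem s)).coord v)
    (fun v => Finset.sum_nonneg fun s _ => mul_nonneg (x.coord_nonneg s) (coord_nonneg _ v))
    (by
      rw [Finset.sum_comm]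
      simp only [← Finset.mul_sum, sum_coord, mul_one])
    (by
      classical
      obtain ⟨s₀, hs₀⟩ := x.exists_coord_ne_zero
      -- The largest simplex of the chain contains all the others.
      obtain ⟨t, ht, htmax⟩ := Finset.exists_max_image (Finset.univ.filter fun s => x.coord s ≠ 0)
        (fun s => (toFace s).card) ⟨s₀, by simpa using hs₀⟩
      refine ⟨toFace t, toFace_mem t, fun v hv => ?_⟩
      obtain ⟨s, -, hs⟩ := Finset.exists_ne_zero_of_sum_ne_zero hv
      have hxs := left_ne_zero_of_mul hs
      have hvs := (coord_barycentre_ne_zero_iff _).1 (right_ne_zero_of_mul hs)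
      rcases toFace_chain x hxs (Finset.mem_filter.1 ht).2 with h | h
      · exact h hvs
      · rwa [Finset.eq_of_subset_of_card_le h (htmax s (by simpa using hxs))])

theorem coord_subdivisionMap (x : X.barycentricSubdivision.Realization) (v : X.Vertex) :
    (subdivisionMap x).coord v =
      ∑ s, x.coord s * (barycentre (toFace s) (toFace_mem s)).coord v := rfl

theorem continuous_subdivisionMap : Continuous (subdivisionMap (X := X)) :=
  continuous_iff.2 fun v => by
    simp only [coord_subdivisionMap]
    exact continuous_finsetSum _ fun s _ => (continuous_coord s).mul continuous_const

/-- If `y_s < x_s`, pick a vertex `v` of `s` outside every other simplex of at most the same size in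
the chain of `y`; it exists because the largest of these does not contain `s`. In the `v`-coordinate
of the difference of images, larger simplices cancel, `s` contributes positively and the rest
nonnegatively, so it cannot vanish. -/
theorem coord_le_of_subdivisionMap_eq {x y : X.barycentricSubdivision.Realization}
    (hxy : subdivisionMap x = subdivisionMap y) (s : X.barycentricSubdivision.Vertex)
    (hs : ∀ t, (toFace s).card < (toFace t).card → x.coord t = y.coord t) :
    x.coord s ≤ y.coord s := by
  classical
  by_contra! hlt
  obtain ⟨v, hvs, hv⟩ : ∃ v ∈ toFace s, ∀ t, y.coord t ≠ 0 → t ≠ s →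
      (toFace t).card ≤ (toFace s).card → v ∉ toFace t := by
    let T := Finset.univ.filter fun t =>
      y.coord t ≠ 0 ∧ t ≠ s ∧ (toFace t).card ≤ (toFace s).card
    have hT : ∀ t, t ∈ T ↔ y.coord t ≠ 0 ∧ t ≠ s ∧ (toFace t).card ≤ (toFace s).card :=
      fun t => by simp [T]
    rcases T.eq_empty_or_nonempty with h | h
    · obtain ⟨v, hv⟩ := faces_nonempty (toFace_mem s)
      refine ⟨v, hv, fun t h1 h2 h3 => absurd ((hT t).2 ⟨h1, h2, h3⟩) ?_⟩
      simp [h]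
    · obtain ⟨t₀, ht₀, hmax⟩ := Finset.exists_max_image T (fun t => (toFace t).card) h
      obtain ⟨h1, h2, h3⟩ := (hT t₀).1 ht₀
      obtain ⟨v, hvs, hvt⟩ := Finset.not_subset.1 fun hsub : toFace s ⊆ toFace t₀ =>
        h2 (toFace_injective (Finset.eq_of_subset_of_card_le hsub h3)).symm
      refine ⟨v, hvs, fun t g1 g2 g3 hvt' => hvt ?_⟩
      rcases toFace_chain y g1 h1 with h' | h'
      · exact h' hvt'
      · rwa [Finset.eq_of_subset_of_card_le h' (hmax t ((hT t).2 ⟨g1, g2, g3⟩))]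
  have hsum : ∑ t, (x.coord t - y.coord t) * (barycentre (toFace t) (toFace_mem t)).coord v = 0 := by
    simp only [sub_mul, Finset.sum_sub_distrib, ← coord_subdivisionMap, hxy, sub_self]
  refine hsum.not_gt (Finset.sum_pos' (fun t _ => ?_) ⟨s, Finset.mem_univ s,
    mul_pos (sub_pos.2 hlt) (coord_barycentre_pos _ hvs)⟩)
  rcases eq_or_ne t s with rfl | hts
  · exact mul_nonneg (sub_pos.2 hlt).le (coord_nonneg _ _)
  rcases lt_or_ge (toFace s).card (toFace t).card with hc | hc
  · simp [hs t hc]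
  by_cases hyt : y.coord t = 0
  · rw [hyt, sub_zero]
    exact mul_nonneg (coord_nonneg _ _) (coord_nonneg _ _)
  · rw [coord_barycentre_of_notMem _ (hv t hyt hts hc), mul_zero]

theorem subdivisionMap_injective : Function.Injective (subdivisionMap (X := X)) := by
  classical
  intro x y hxy
  by_contra hne
  obtain ⟨s₀, hs₀⟩ : ∃ s, x.coord s ≠ y.coord s := by
    by_contra! h
    exact hne (Realization.ext h)
  -- Compare at a largest simplex where the coordinates differ.
  obtain ⟨s, hs, hmax⟩ := Finset.exists_max_image
    (Finset.univ.filter fun s => x.coord s ≠ y.coord s) (fun s => (toFace s).card)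
    ⟨s₀, by simpa using hs₀⟩
  have h : ∀ t, (toFace s).card < (toFace t).card → x.coord t = y.coord t := fun t ht => by
    by_contra hne'
    exact (hmax t (by simpa using hne')).not_gt ht
  exact (Finset.mem_filter.1 hs).2 (le_antisymm (coord_le_of_subdivisionMap_eq hxy s h)
    (coord_le_of_subdivisionMap_eq hxy.symm s fun t ht => (h t ht).symm))

/-- Every nonnegative function whose support spans a simplex is a combination of barycentres along
a chain of simplices. -/
theorem exists_chain_combination (n : ℕ) (a : X.Vertex → ℝ) (ha : ∀ v, 0 ≤ a v)
    (hn : {v | a v ≠ 0}.ncard ≤ n)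
    (hface : ∀ s : Finset X.Vertex, s.Nonempty → (∀ v ∈ s, a v ≠ 0) → s ∈ X.faces) :
    ∃ l : X.barycentricSubdivision.Vertex → ℝ, (∀ s, 0 ≤ l s) ∧
      (∀ s, l s ≠ 0 → ∀ v ∈ toFace s, a v ≠ 0) ∧
      (∀ s t, l s ≠ 0 → l t ≠ 0 → toFace s ⊆ toFace t ∨ toFace t ⊆ toFace s) ∧
      ∀ v, ∑ s, l s * (barycentre (toFace s) (toFace_mem s)).coord v = a v := by
  classical
  induction n generalizing a with
  | zero =>
    have h0 : ∀ v, a v = 0 := fun v => by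
      by_contra hv
      have : {v | a v ≠ 0} = ∅ := (Set.ncard_eq_zero (Set.toFinite _)).1 (Nat.le_zero.1 hn)
      exact this.subset hv
    exact ⟨0, fun _ => le_rfl, fun s hs => absurd rfl hs, fun s _ hs => absurd rfl hs,
      fun v => by simp [h0]⟩
  | succ n ih =>
    let S := Finset.univ.filter fun v => a v ≠ 0
    have hS : ∀ v, v ∈ S ↔ a v ≠ 0 := fun v => by simp [S]
    rcases S.eq_empty_or_nonempty with hemp | hne
    · have h0 : ∀ v, a v = 0 := fun v => by
        by_contra hv
        have := (hS v).2 hv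
        simp [hemp] at this
      exact ⟨0, fun _ => le_rfl, fun s hs => absurd rfl hs, fun s _ hs => absurd rfl hs,
        fun v => by simp [h0]⟩
    obtain ⟨v₀, hv₀, hmin⟩ := Finset.exists_min_image S a hne
    have hSf := hface S hne fun v hv => (hS v).1 hv
    -- Subtracting the minimal value on the support kills at least `v₀`. What is removed is `a v₀`
    -- on all of `S`, that is, `a v₀ * S.card` times the barycentre of `S`, and `S` sits on top of
    -- the chain for `a'`.
    let a' : X.Vertex → ℝ := fun v => if v ∈ S then a v - a v₀ else 0
    have ha' : ∀ v, a' v ≠ 0 → a v ≠ 0 ∧ v ≠ v₀ := fun v hv => by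
      by_cases h : v ∈ S
      · refine ⟨(hS v).1 h, ?_⟩
        rintro rfl
        simp [a'] at hv
      · simp [a', h] at hv
    obtain ⟨l, hl0, hlS, hlc, hl⟩ := ih a'
      (fun v => by
        by_cases h : v ∈ S
        · simpa [a', h] using hmin v h
        · simp [a', h])
      (by
        have : {v | a' v ≠ 0}.ncard < {v | a v ≠ 0}.ncard :=
          Set.ncard_lt_ncard ⟨fun v hv => (ha' v hv).1, fun h =>
            (ha' v₀ (h ((hS v₀).1 hv₀))).2 rfl⟩ (Set.toFinite _)
        omega)
      fun s hs hsa => hface s hs fun v hv => (ha' v (hsa v hv)).1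
    obtain ⟨s₀, hs₀⟩ := exists_toFace_eq hSf
    have hcases : ∀ s, l s + (if s = s₀ then a v₀ * S.card else 0) ≠ 0 → s = s₀ ∨ l s ≠ 0 := fun s hs => by
      by_cases h : s = s₀
      · exact Or.inl h
      · exact Or.inr (by simpa [h] using hs)
    have hsub : ∀ s, l s ≠ 0 → toFace s ⊆ toFace s₀ := fun s hs v hv => by
      rw [hs₀, hS]
      exact (ha' v (hlS s hs v hv)).1
    refine ⟨fun s => l s + (if s = s₀ then a v₀ * S.card else 0), fun s => ?_, fun s hs v hv => ?_,
      fun s t hs ht => ?_, fun v => ?_⟩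
    · refine add_nonneg (hl0 s) ?_
      split_ifs
      · exact mul_nonneg (ha v₀) (Nat.cast_nonneg _)
      · exact le_rfl
    · rcases hcases s hs with rfl | h
      · exact (hS v).1 (hs₀ ▸ hv)
      · exact (ha' v (hlS s h v hv)).1
    · rcases hcases s hs with rfl | h <;> rcases hcases t ht with rfl | h'
      · exact Or.inl subset_rfl
      · exact Or.inr (hsub t h')
      · exact Or.inl (hsub s h)
      · exact hlc s t h h'
    · simp only [add_mul, Finset.sum_add_distrib, hl v, ite_mul, zero_mul, Finset.sum_ite_eq',
        Finset.mem_univ, if_true]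
      by_cases h : v ∈ S
      · rw [coord_barycentre_of_mem _ (hs₀ ▸ h), hs₀, mul_inv_cancel_right₀
          (Nat.cast_ne_zero.2 (Finset.card_pos.2 hne).ne')]
        simp [a', h]
      · rw [coord_barycentre_of_notMem _ (hs₀ ▸ h)]
        have : a v = 0 := by
          by_contra h0
          exact h ((hS v).2 h0)
        simp [a', h, this]

theorem subdivisionMap_surjective : Function.Surjective (subdivisionMap (X := X)) := by
  classical
  intro x
  obtain ⟨l, hl0, -, hlc, hl⟩ := exists_chain_combination _ x.coord x.coord_nonneg le_rfl
    fun s hs h => x.mem_faces hs h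
  have hsum : ∑ s, l s = 1 := by
    rw [← x.sum_coord]
    simp only [← hl]
    rw [Finset.sum_comm]
    simp only [← Finset.mul_sum, sum_coord, mul_one]
  refine ⟨Realization.mk l hl0 hsum ⟨Finset.univ.filter fun s => l s ≠ 0,
    mem_faces_barycentricSubdivision_iff.2 ⟨?_, ?_⟩, fun s hs => by simpa using hs⟩,
    Realization.ext hl⟩
  · obtain ⟨s, hs, hs'⟩ := Finset.exists_ne_zero_of_sum_ne_zero (hsum.trans_ne one_ne_zero)
    exact ⟨s, by simpa using hs'⟩
  · intro s hs t ht
    exact hlc s t (Finset.mem_filter.1 hs).2 (Finset.mem_filter.1 ht).2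

/-- The realisation of the barycentric subdivision is homeomorphic to that of the complex. -/
noncomputable def subdivisionHomeomorph (X : FiniteSimplicialComplex.{u}) :
    X.barycentricSubdivision.Realization ≃ₜ X.Realization :=
  Continuous.homeoOfEquivCompactToT2
    (f := Equiv.ofBijective subdivisionMap ⟨subdivisionMap_injective, subdivisionMap_surjective⟩)
    continuous_subdivisionMap

theorem subdivisionHomeomorph_apply (x : X.barycentricSubdivision.Realization) :
    subdivisionHomeomorph X x = subdivisionMap x := rfl

end Subdivision

end FiniteSimplicialComplex

namespace FiniteSimplicialComplex

/-! ### Small simplices and the Lebesgue number -/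

open Realization

variable {X Y : FiniteSimplicialComplex.{u}}

/-- The coordinates sum to 1, so the difference is a weighted mean of the `L v - A`. The bound may
vary with `v`, so that a vertex with no error can be counted as such. -/
theorem norm_sum_coord_smul_sub_le {E : Type*} [NormedAddCommGroup E] [NormedSpace ℝ E]
    (y : Y.Realization) (L : Y.Vertex → E) (A : E) (b : Y.Vertex → ℝ)
    (h : ∀ v, y.coord v ≠ 0 → ‖L v - A‖ ≤ b v) :
    ‖∑ v, y.coord v • L v - A‖ ≤ ∑ v, y.coord v * b v := by
  have h1 : ∑ v, y.coord v • L v - A = ∑ v, y.coord v • (L v - A) := by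
    simp only [smul_sub, Finset.sum_sub_distrib, ← Finset.sum_smul, sum_coord, one_smul]
  rw [h1]
  refine (norm_sum_le _ _).trans (Finset.sum_le_sum fun v _ => ?_)
  rw [norm_smul, Real.norm_of_nonneg (y.coord_nonneg v)]
  by_cases hv : y.coord v = 0
  · simp [hv]
  · exact mul_le_mul_of_nonneg_left (h v hv) (y.coord_nonneg v)

/-- An affine map that is `δ`-small on the simplices of a complex with at most `N` vertices is
`(1 - 1 / N) δ`-small on those of the barycentric subdivision. -/
theorem norm_sum_barycentre_sub_le {E : Type*} [NormedAddCommGroup E] [NormedSpace ℝ E]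
    {L : Y.Vertex → E} {δ : ℝ} (hδ : 0 ≤ δ) {N : ℕ}
    (hL : ∀ s ∈ Y.faces, ∀ v ∈ s, ∀ w ∈ s, ‖L v - L w‖ ≤ δ) {s t : Finset Y.Vertex}
    (hs : s ∈ Y.faces) (ht : t ∈ Y.faces) (hst : s ⊆ t) (htN : t.card ≤ N) :
    ‖∑ v, (barycentre s hs).coord v • L v - ∑ v, (barycentre t ht).coord v • L v‖ ≤
      (1 - (N : ℝ)⁻¹) * δ := by
  classical
  refine (norm_sum_coord_smul_sub_le _ L _ (fun _ => (1 - (N : ℝ)⁻¹) * δ) fun v hv => ?_).trans_eq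
    (by rw [← Finset.sum_mul, sum_coord, one_mul])
  have hvt : v ∈ t := hst ((coord_barycentre_ne_zero_iff hs).1 hv)
  rw [norm_sub_rev]
  -- The vertex `v` itself contributes no error and has weight `1 / t.card ≥ 1 / N`; this is the
  -- gain.
  refine (norm_sum_coord_smul_sub_le _ L _ (fun w => if w = v then 0 else δ) fun w hw => ?_).trans ?_
  · split_ifs with h
    · simp [h]
    · exact hL t ht w ((coord_barycentre_ne_zero_iff ht).1 hw) v hvt
  · have h1 : ∀ w, (barycentre t ht).coord w * (if w = v then 0 else δ) =
        (barycentre t ht).coord w * δ - if w = v then (barycentre t ht).coord w * δ else 0 :=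
      fun w => by split_ifs <;> ring
    simp only [h1, Finset.sum_sub_distrib, Finset.sum_ite_eq', Finset.mem_univ, if_true,
      ← Finset.sum_mul, sum_coord, coord_barycentre_of_mem ht hvt, ← sub_mul]
    refine mul_le_mul_of_nonneg_right (sub_le_sub_left ?_ 1) hδ
    exact inv_anti₀ (Nat.cast_pos.2 (Finset.card_pos.2 ⟨v, hvt⟩)) (Nat.cast_le.2 htN)

/-- Sizes strictly increase along a chain. One `N` thus serves all iterated subdivisions, and the
contraction factor stays fixed. -/
theorem card_le_of_mem_faces_barycentricSubdivision {N : ℕ} (hN : ∀ s ∈ Y.faces, s.card ≤ N)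
    {c : Finset Y.barycentricSubdivision.Vertex} (hc : c ∈ Y.barycentricSubdivision.faces) :
    c.card ≤ N := by
  have h := Finset.card_le_card_of_injOn (s := c) (t := Finset.Icc 1 N)
    (fun s => (toFace s).card)
    (fun s _ => Finset.mem_coe.2 (Finset.mem_Icc.2
      ⟨Finset.card_pos.2 (faces_nonempty (toFace_mem s)), hN _ (toFace_mem s)⟩))
    fun s hs t ht hst => toFace_injective <| by
      rcases (mem_faces_barycentricSubdivision_iff.1 hc).2 s hs t ht with h | h
      · exact Finset.eq_of_subset_of_card_le h hst.ge
      · exact (Finset.eq_of_subset_of_card_le h hst.le).symm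
  simpa using h

/-- Iterated barycentric subdivisions have homeomorphic realisations, along a map that is affine
on simplices and maps simplices to sets of small diameter. -/
theorem exists_homeomorph_iterate_barycentricSubdivision (X : FiniteSimplicialComplex.{u}) {N : ℕ}
    (hN : ∀ s ∈ X.faces, s.card ≤ N) (hN0 : 0 < N) (n : ℕ) :
    ∃ (e : (barycentricSubdivision^[n] X).Realization ≃ₜ X.Realization)
      (L : (barycentricSubdivision^[n] X).Vertex → X.Vertex → ℝ),
      (∀ y, (e y).coord = ∑ w, y.coord w • L w) ∧
      (∀ s ∈ (barycentricSubdivision^[n] X).faces, ∀ v ∈ s, ∀ w ∈ s,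
        ‖L v - L w‖ ≤ (1 - (N : ℝ)⁻¹) ^ n) ∧
      ∀ s ∈ (barycentricSubdivision^[n] X).faces, s.card ≤ N := by
  classical
  have hN1 : (0 : ℝ) ≤ 1 - (N : ℝ)⁻¹ :=
    sub_nonneg.2 (inv_le_one_of_one_le₀ (Nat.one_le_cast.2 hN0))
  induction n with
  | zero =>
    have h1 : ∀ y : X.Realization, y.coord = ∑ w, y.coord w • (Pi.single w 1 : X.Vertex → ℝ) :=
      fun y => by
        funext v
        simp [Finset.sum_apply, Pi.single_apply]
    have h2 : ∀ v w : X.Vertex, ‖(Pi.single v 1 - Pi.single w 1 : X.Vertex → ℝ)‖ ≤ 1 :=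
      fun v w => by
        rw [pi_norm_le_iff_of_nonneg zero_le_one]
        intro i
        simp only [Pi.sub_apply, Pi.single_apply]
        split_ifs <;> simp
    exact ⟨Homeomorph.refl _, fun v : X.Vertex => Pi.single v 1, h1,
      fun _ _ v _ w _ => (h2 v w).trans_eq (pow_zero _).symm, hN⟩
  | succ n ih =>
    obtain ⟨e, L, he, hL, hcard⟩ := ih
    rw [Function.iterate_succ_apply']
    generalize barycentricSubdivision^[n] X = Y at e L he hL hcard
    refine ⟨(subdivisionHomeomorph Y).trans e,
      fun s => ∑ v, (barycentre (toFace s) (toFace_mem s)).coord v • L v, fun y => ?_,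
      fun c hc s hs t ht => ?_, fun c hc => card_le_of_mem_faces_barycentricSubdivision hcard hc⟩
    · rw [Homeomorph.trans_apply, he, subdivisionHomeomorph_apply]
      simp only [coord_subdivisionMap, Finset.sum_smul, Finset.smul_sum, smul_smul]
      exact Finset.sum_comm
    · rw [pow_succ']
      rcases (mem_faces_barycentricSubdivision_iff.1 hc).2 s hs t ht with h | h
      · exact norm_sum_barycentre_sub_le (pow_nonneg hN1 n) hL _ _ h (hcard _ (toFace_mem t))
      · rw [norm_sub_rev]
        exact norm_sum_barycentre_sub_le (pow_nonneg hN1 n) hL _ _ h (hcard _ (toFace_mem s))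

/-- For every open cover of the realisation there is an iterated barycentric subdivision all of
whose open vertex stars lie in members of the cover. -/
theorem exists_iterate_barycentricSubdivision_openStar_subset (X : FiniteSimplicialComplex.{u})
    {ι : Type*} {U : ι → Set X.Realization} (hU : ∀ i, IsOpen (U i)) (hcov : ⋃ i, U i = Set.univ) :
    ∃ (n : ℕ) (e : (barycentricSubdivision^[n] X).Realization ≃ₜ X.Realization),
      ∀ v, ∃ i, openStar {v} ⊆ e ⁻¹' U i := by
  classical
  -- The Lebesgue number is taken in the ambient coordinate space, where the realisation is compact.
  choose O hO hOU using fun i => isInducing_coord.isOpen_iff.1 (hU i)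
  obtain ⟨δ, hδ, hball⟩ := lebesgue_number_lemma_of_metric
    (isCompact_range (isInducing_coord (X := X)).continuous) hO (by
      rintro _ ⟨x, rfl⟩
      obtain ⟨i, hi⟩ := Set.mem_iUnion.1 (hcov.symm.subset (Set.mem_univ x))
      rw [← hOU i] at hi
      exact Set.mem_iUnion.2 ⟨i, hi⟩)
  -- The extra 1 keeps `N` positive for the empty complex.
  let N := Fintype.card X.Vertex + 1
  have hN0 : (0 : ℝ) < (N : ℝ)⁻¹ := inv_pos.2 (Nat.cast_pos.2 (Nat.succ_pos _))
  obtain ⟨n, hn⟩ := exists_pow_lt_of_lt_one hδ (sub_lt_self 1 hN0)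
  obtain ⟨e, L, he, hL, -⟩ := exists_homeomorph_iterate_barycentricSubdivision X (N := N)
    (fun s _ => (Finset.card_le_univ s).trans (Nat.le_succ _)) (Nat.succ_pos _) n
  refine ⟨n, e, fun v => ?_⟩
  have hv : ({v} : Finset (barycentricSubdivision^[n] X).Vertex) ∈
      (barycentricSubdivision^[n] X).faces := (barycentricSubdivision^[n] X).complex.singleton_mem v
  have hLv : (e (barycentre {v} hv)).coord = L v := by
    rw [he, Finset.sum_eq_single v (fun w _ hw => by
      rw [coord_barycentre_of_notMem hv (by simpa using hw), zero_smul])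
      (fun h => absurd (Finset.mem_univ v) h), coord_barycentre_of_mem hv (by simp)]
    simp
  obtain ⟨i, hi⟩ := hball (L v) (hLv ▸ Set.mem_range_self _)
  refine ⟨i, fun y hy => ?_⟩
  change e y ∈ U i
  rw [← hOU i]
  refine hi ?_
  rw [Metric.mem_ball, dist_eq_norm, he]
  refine (norm_sum_coord_smul_sub_le y L (L v) (fun _ => (1 - (N : ℝ)⁻¹) ^ n) fun w hw => ?_).trans_lt ?_
  · refine hL {w, v} (y.mem_faces ⟨w, by simp⟩ fun z hz => ?_) w (by simp) v (by simp)
    rcases Finset.mem_insert.1 hz with rfl | hz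
    · exact hw
    · exact hy z hz
  · rwa [← Finset.sum_mul, sum_coord, one_mul]

theorem exists_fibreCollapsing_of_gCat_closure_le {𝒢 : GroupClass.{u}} (hiso : 𝒢.ClosedUnderIso)
    {k : ℕ} (h : gCat 𝒢.closure X.Realization ≤ (k : ℕ∞) + 1) :
    ∃ n : ℕ, (barycentricSubdivision^[n] X).FibreCollapsing 𝒢 k := by
  obtain ⟨𝒰, hfin, h𝒰, hcard⟩ : gCat 𝒢.closure X.Realization ∈ {n : ℕ∞ | ∃ 𝒰 : Set (Set X.Realization),
      𝒰.Finite ∧ IsOpenGCover 𝒢.closure 𝒰 ∧ 𝒰.encard = n} := by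
    -- A finite category is attained by an actual cover, whose members serve as colours.
    refine csInf_mem (Set.nonempty_iff_ne_empty.2 fun hemp => ?_)
    rw [gCat, hemp, sInf_empty, top_le_iff] at h
    exact absurd h (by exact_mod_cast ENat.natCast_ne_top (k + 1))
  have := hfin.fintype
  obtain ⟨n, e, he⟩ := exists_iterate_barycentricSubdivision_openStar_subset X
    (U := fun i : 𝒰 => (i : Set X.Realization)) (fun i => h𝒰.isOpen i i.2)
    (by rw [← Set.sUnion_eq_iUnion, h𝒰.sUnion_eq])
  choose c hc using he
  refine ⟨n, fibreCollapsing_of_colouring hiso ?_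
    (fun i : 𝒰 => (h𝒰.isGSet i i.2).preimage_homeomorph hiso.closure e) c hc⟩
  rw [← hcard, Set.encard_eq_coe_toFinset_card, Set.toFinset_card] at h
  exact_mod_cast h

end FiniteSimplicialComplex

theorem gCat_closure_le {X : Type u} [TopologicalSpace X] {𝒢 : GroupClass.{u}}
    (hfg : 𝒢.ClosedUnderFGSubgroups) : gCat 𝒢.closure X ≤ gCat 𝒢 X :=
  sInf_le_sInf fun _ ⟨𝒰, hfin, h, hn⟩ => ⟨𝒰, hfin,
    ⟨h.isOpen, fun U hU x => GroupClass.le_closure hfg _ (h.isGSet U hU x), h.sUnion_eq⟩, hn⟩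

theorem mainTheorem8 (X : FiniteSimplicialComplex.{u}) (k : ℕ) (𝒢 : GroupClass.{u})
    (hiso : 𝒢.ClosedUnderIso) (hfg : 𝒢.ClosedUnderFGSubgroups) :
    List.TFAE
      [∃ n : ℕ, (FiniteSimplicialComplex.barycentricSubdivision^[n] X).FibreCollapsing 𝒢 k,
        gCat 𝒢 X.Realization ≤ (k : ℕ∞) + 1,
        gCat 𝒢.closure X.Realization ≤ (k : ℕ∞) + 1] := by
  tfae_have 1 → 2 := by
    rintro ⟨n, h⟩
    obtain ⟨e, -⟩ := FiniteSimplicialComplex.exists_homeomorph_iterate_barycentricSubdivision X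
      (N := Fintype.card X.Vertex + 1)
      (fun s _ => (Finset.card_le_univ s).trans (Nat.le_succ _)) (Nat.succ_pos _) n
    exact (gCat_le_of_homeomorph hiso e.symm).trans (h.gCat_le hiso)
  tfae_have 2 → 3 := (gCat_closure_le hfg).trans
  tfae_have 3 → 1 := FiniteSimplicialComplex.exists_fibreCollapsing_of_gCat_closure_le hiso
  tfae_finish
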